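/- Let $d\ge 1$, $s>\frac d2+1$, $\kappa\ge 0$, $T>0$, and let $\mathbb T^d=(\mathbb R/\mathbb Z)^d$. Let $$(\rho,u,\Phi)\in C\big([0,T];H^{s}(\mathbb T^d)\times H^{s}(\mathbb T^d;\mathbb R^d)\times H^{s+1}(\mathbb T^d)\big)$$ be a classical solution on $(0,T)\times\mathbb T^d$ of the ionic Euler–Poisson system $$\partial_t\rho+\nabla\cdot(\rho u)=0,\qquad \partial_t(\rho u)+\nabla\cdot(\rho u\otimes u+\kappa\rho\,\mathbb I)=-\rho\nabla\Phi,\qquad -\Delta\Phi=\rho-e^{\Phi},$$ where $\rho(t),u(t)$ are of class $C^1$ and $\Phi(t)$ of class $C^2$ in $x$ for every $t\in(0,T)$. Set $\rho_e:=e^{\Phi}$. Then there is a velocity field $u_e\in L^\infty(0,T;H^{s+1}(\mathbb T^d;\mathbb R^d))$ with $u_e(t)$ of class $C^1$ for every $t\in(0,T)$ such that $\rho_e$ is differentiable in $t$ and $$\partial_t\rho_e+\nabla\cdot(\rho_e u_e)=0$$ holds at every point of $(0,T)\times\mathbb T^d$. Moreover $u_e$ can be chosen so that, for every $t\in(0,T)$,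 the flux $\rho_e u_e$ is the gradient of a $C^1$ function on $\mathbb T^d$, and it is unique with this property: if $w\in L^\infty(0,T;H^{s+1}(\mathbb T^d;\mathbb R^d))$ is such that, for almost every $t\in(0,T)$, $w(t)$ is of class $C^1$, the equation $\partial_t\rho_e+\nabla\cdot(\rho_e w)=0$ holds on $\mathbb T^d$, and $\rho_e w$ is the gradient of a $C^1$ function on $\mathbb T^d$, then $w(t)=u_e(t)$ for almost every $t\in(0,T)$. -/

import Mathlib

open MeasureTheory Set

/-!
Periodic functions live on Mathlib's flat torus `UnitAddTorus (Fin d) = (ℝ / ℤ)^d`, with its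
Haar probability measure `torusMeasure` and its Fourier coefficients `UnitAddTorus.mFourierCoeff`.
Time-dependent functions are maps `ℝ → UnitAddTorus (Fin d) → ℝ`; only times in `[0,T]` matter.
-/

noncomputable section

namespace IonicEulerPoisson

variable {d : ℕ}

/-! ### Classical derivatives on the torus -/

/-- `f` is of class `C^n` on the torus: its periodic lift to `ℝ^d` is `C^n`. -/
def IsCn (n : ℕ) (f : UnitAddTorus (Fin d) → ℝ) : Prop :=
  ContDiff ℝ n (fun y : Fin d → ℝ => f (fun i => (y i : UnitAddCircle)))

/-- The partial derivative `∂_i f (x)`: the derivative of `f` along the `i`-th coordinate circle. -/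
def pderiv (i : Fin d) (f : UnitAddTorus (Fin d) → ℝ) (x : UnitAddTorus (Fin d)) : ℝ :=
  deriv (fun h : ℝ => f (x + Pi.single i (h : UnitAddCircle))) 0

/-- The divergence `∇ · v = ∑ i, ∂_i v_i` of a vector field on the torus. -/
def divergence (v : UnitAddTorus (Fin d) → Fin d → ℝ) (x : UnitAddTorus (Fin d)) : ℝ :=
  ∑ i, pderiv i (fun y => v y i) x

/-- The Laplacian `Δ f = ∑ i, ∂_i ∂_i f`. -/
def laplacian (f : UnitAddTorus (Fin d) → ℝ) (x : UnitAddTorus (Fin d)) : ℝ :=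
  ∑ i, pderiv i (pderiv i f) x

/-- The Haar (Lebesgue) probability measure on the torus, the same measure with respect to which
Mathlib's `UnitAddTorus.mFourierCoeff` integrates. -/
def torusMeasure (d : ℕ) : Measure (UnitAddTorus (Fin d)) :=
  Measure.pi fun _ => AddCircle.haarAddCircle

/-! ### Sobolev spaces of real order `σ ≥ 0` on the torus -/

/-- The Bessel weight `(1 + |k|²)^(σ/2)`. -/
def sobolevWeight (σ : ℝ) (k : Fin d → ℤ) : ℝ :=
  (1 + ∑ i, (k i : ℝ) ^ 2) ^ (σ / 2)

/-- The Hilbert space `ℓ²(ℤ^d; ℂ)`. -/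
abbrev CoeffSpace (d : ℕ) : Type := lp (fun _ : Fin d → ℤ => ℂ) 2

/-- `f ∈ H^σ(𝕋^d)`, and `F` is its image under the isometric embedding
`H^σ(𝕋^d) → ℓ²(ℤ^d)`, `f ↦ ((1 + |k|²)^(σ/2) f̂(k))_k`. In particular
`‖f‖_{H^σ} = ‖F‖`, and `f ∈ H^σ` exactly when such an `F` exists. -/
def IsSobolevWith (σ : ℝ) (f : UnitAddTorus (Fin d) → ℝ) (F : CoeffSpace d) : Prop :=
  MemLp f 2 (torusMeasure d) ∧
    ∀ k : Fin d → ℤ, F k =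
      (sobolevWeight σ k : ℂ) * UnitAddTorus.mFourierCoeff (fun x => (f x : ℂ)) k

/-- `f ∈ C([0,T]; H^σ(𝕋^d))`, continuity being with respect to the `H^σ` norm. -/
def ContSobolev (T σ : ℝ) (f : ℝ → UnitAddTorus (Fin d) → ℝ) : Prop :=
  ∃ F : ℝ → CoeffSpace d, ContinuousOn F (Icc 0 T) ∧
    ∀ t ∈ Icc (0 : ℝ) T, IsSobolevWith σ (f t) (F t)

/-- `f ∈ L^∞(0,T; H^σ(𝕋^d))`: strongly measurable with values in `H^σ` and with essentially
bounded `H^σ` norm. -/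
def LinftySobolev (T σ : ℝ) (f : ℝ → UnitAddTorus (Fin d) → ℝ) : Prop :=
  ∃ F : ℝ → CoeffSpace d, MemLp F ⊤ (volume.restrict (Ioo 0 T)) ∧
    ∀ᵐ t ∂(volume.restrict (Ioo 0 T)), IsSobolevWith σ (f t) (F t)

/-! ### The ionic Euler–Poisson system -/

/-- `(ρ, u, Φ)` is a classical solution on `(0,T) × 𝕋^d` of
`∂_t ρ + ∇·(ρu) = 0`, `∂_t (ρu) + ∇·(ρ u ⊗ u + κ ρ I) = -ρ ∇Φ`, `-ΔΦ = ρ - e^Φ`. -/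
structure IsClassicalSolution (κ T : ℝ) (ρ : ℝ → UnitAddTorus (Fin d) → ℝ)
    (u : ℝ → UnitAddTorus (Fin d) → Fin d → ℝ) (Φ : ℝ → UnitAddTorus (Fin d) → ℝ) : Prop where
  density_C1 : ∀ t ∈ Ioo (0 : ℝ) T, IsCn 1 (ρ t)
  velocity_C1 : ∀ t ∈ Ioo (0 : ℝ) T, ∀ i, IsCn 1 (fun x => u t x i)
  potential_C2 : ∀ t ∈ Ioo (0 : ℝ) T, IsCn 2 (Φ t)
  mass : ∀ t ∈ Ioo (0 : ℝ) T, ∀ x,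
    HasDerivAt (fun τ => ρ τ x) (-divergence (fun y i => ρ t y * u t y i) x) t
  momentum : ∀ t ∈ Ioo (0 : ℝ) T, ∀ x, ∀ i,
    HasDerivAt (fun τ => ρ τ x * u τ x i)
      (-divergence (fun y j => ρ t y * u t y i * u t y j + if i = j then κ * ρ t y else 0) x
        - ρ t x * pderiv i (Φ t) x) t
  poisson : ∀ t ∈ Ioo (0 : ℝ) T, ∀ x, -laplacian (Φ t) x = ρ t x - Real.exp (Φ t x)

/-! ### The electron velocity field -/

/-- The electron density `ρ_e = e^Φ`. -/
def electronDensity (Φ : ℝ → UnitAddTorus (Fin d) → ℝ) (t : ℝ) (x : UnitAddTorus (Fin d)) : ℝ :=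
  Real.exp (Φ t x)

/-- At time `t`, the field `w(t)` is `C^1` in space, `ρ_e` is differentiable in time, and
`∂_t ρ_e + ∇·(ρ_e w) = 0` holds at every point of the torus. -/
def ContinuityEqAt (Φ : ℝ → UnitAddTorus (Fin d) → ℝ)
    (w : ℝ → UnitAddTorus (Fin d) → Fin d → ℝ) (t : ℝ) : Prop :=
  (∀ i, IsCn 1 (fun x => w t x i)) ∧
    ∀ x, HasDerivAt (fun τ => electronDensity Φ τ x)
      (-divergence (fun y i => electronDensity Φ t y * w t y i) x) t

/-- At time `t`, the electron flux `ρ_e w` is the gradient of a function on the torus. -/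
def GradientFluxAt (Φ : ℝ → UnitAddTorus (Fin d) → ℝ)
    (w : ℝ → UnitAddTorus (Fin d) → Fin d → ℝ) (t : ℝ) : Prop :=
  ∃ ψ : UnitAddTorus (Fin d) → ℝ, IsCn 1 ψ ∧
    ∀ x i, electronDensity Φ t x * w t x i = pderiv i ψ x

end IonicEulerPoisson

end

/-! The electron velocity is `u_e = e^{-Φ} ∇(-Δ)⁻¹ ∂_t e^Φ`: its flux is a gradient and has
divergence `-∂_t e^Φ`, provided `∂_t e^Φ` has mean zero. The real content is that `Φ` is
differentiable in time with values in `H^{s+1}`, with no loss of derivatives.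

Write `s = σ + 1`, so `σ > d/2`. The mass equation places `∂_t ρ = -∇·(ρu)` in `H^σ`, continuously
in time. Applying `(1-Δ)⁻¹` to the Poisson equation gives `Φ + (1-Δ)⁻¹(e^Φ - Φ) = (1-Δ)⁻¹ρ`, an
equation in `H^{σ+2}` whose right side is differentiable in time there. The derivative of the left
side in `Φ` is `1 + (1-Δ)⁻¹(e^Φ - 1)`, a compact perturbation of the identity. An energy identity
makes it injective, the Fredholm alternative makes it invertible (`isUnit_ellip`), and the inverse
function theorem differentiates `Φ` (`hasDerivAt_of_poissonMap`). Integrating the linearized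
equation shows that `∂_t e^Φ` has mean zero (`electronRate_apply_zero`). Every operation depends
continuously on the data, so `u_e` is bounded in `H^{σ+2}` on the compact interval `[0,T]`.

For uniqueness, the difference of two admissible fluxes is a divergence-free gradient, and
integration by parts kills it (`eq_zero_of_divergence_eq_zero`).

A Sobolev function is encoded by its weighted Fourier coefficients in `ℓ²`, the same space for all
exponents. The exponent enters only through the evaluation `ev`, and operators between different
Sobolev spaces become bounded multipliers on `ℓ²`. Identities between elements are checked pointwise
through `ev_injective` or coefficientwise through `wco_injective`. -/

noncomputable section

namespace IonicEulerPoisson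

variable {d : ℕ}

open UnitAddTorus ComplexConjugate

/-! ### The Bessel weight -/

/-- The squared Japanese bracket `1 + |k|²`. -/
def bracketSq (k : Fin d → ℤ) : ℝ := 1 + ∑ i, (k i : ℝ) ^ 2

lemma one_le_bracketSq (k : Fin d → ℤ) : 1 ≤ bracketSq k := by
  have : 0 ≤ ∑ i, (k i : ℝ) ^ 2 := Finset.sum_nonneg fun i _ => sq_nonneg _
  unfold bracketSq; linarith

lemma bracketSq_pos (k : Fin d → ℤ) : 0 < bracketSq k := zero_lt_one.trans_le (one_le_bracketSq k)

lemma sobolevWeight_eq (σ : ℝ) (k : Fin d → ℤ) : sobolevWeight σ k = bracketSq k ^ (σ / 2) := rfl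

lemma sobolevWeight_pos (σ : ℝ) (k : Fin d → ℤ) : 0 < sobolevWeight σ k :=
  Real.rpow_pos_of_pos (bracketSq_pos k) _

lemma sobolevWeight_add (σ τ : ℝ) (k : Fin d → ℤ) :
    sobolevWeight (σ + τ) k = sobolevWeight σ k * sobolevWeight τ k := by
  simp only [sobolevWeight_eq, ← Real.rpow_add (bracketSq_pos k), add_div]

lemma sobolevWeight_mono {σ τ : ℝ} (h : σ ≤ τ) (k : Fin d → ℤ) :
    sobolevWeight σ k ≤ sobolevWeight τ k :=
  Real.rpow_le_rpow_of_exponent_le (one_le_bracketSq k) (by linarith)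

lemma sobolevWeight_sq (σ : ℝ) (k : Fin d → ℤ) : sobolevWeight σ k ^ 2 = bracketSq k ^ σ := by
  rw [sobolevWeight_eq, ← Real.rpow_natCast, ← Real.rpow_mul (bracketSq_pos k).le]
  congr 1; push_cast; ring

lemma sobolevWeight_two (k : Fin d → ℤ) : sobolevWeight 2 k = bracketSq k := by
  rw [sobolevWeight_eq]; norm_num

lemma sobolevWeight_zero_right (σ : ℝ) : sobolevWeight σ (0 : Fin d → ℤ) = 1 := by
  simp [sobolevWeight]

lemma abs_le_sobolevWeight_one (k : Fin d → ℤ) (i : Fin d) : |(k i : ℝ)| ≤ sobolevWeight 1 k := by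
  refine abs_le_of_sq_le_sq ?_ (sobolevWeight_pos 1 k).le
  rw [sobolevWeight_sq, Real.rpow_one]
  have : (k i : ℝ) ^ 2 ≤ ∑ i, (k i : ℝ) ^ 2 :=
    Finset.single_le_sum (f := fun i => (k i : ℝ) ^ 2) (fun i _ => sq_nonneg _) (Finset.mem_univ i)
  unfold bracketSq; linarith

/-- Peetre's inequality. -/
lemma sobolevWeight_sq_le {σ : ℝ} (hσ : 0 ≤ σ) (k l : Fin d → ℤ) :
    sobolevWeight σ k ^ 2 ≤ 4 ^ σ * (sobolevWeight σ l ^ 2 + sobolevWeight σ (k - l) ^ 2) := by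
  simp only [sobolevWeight_sq]
  have hb : bracketSq k ≤ 2 * (bracketSq l + bracketSq (k - l)) := by
    have : ∑ i, (k i : ℝ) ^ 2 ≤ ∑ i, (2 * (l i : ℝ) ^ 2 + 2 * ((k - l) i : ℝ) ^ 2) := by
      refine Finset.sum_le_sum fun i _ => ?_
      push_cast [Pi.sub_apply]
      nlinarith [sq_nonneg ((k i : ℝ) - 2 * l i)]
    rw [Finset.sum_add_distrib, ← Finset.mul_sum, ← Finset.mul_sum] at this
    unfold bracketSq; linarith
  have h1 := Real.rpow_nonneg (bracketSq_pos l).le σ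
  have h2 := Real.rpow_nonneg (bracketSq_pos (k - l)).le σ
  have h4 : (0 : ℝ) ≤ 4 ^ σ := by positivity
  -- The sum of the two brackets is at most twice the larger one. This turns the factor `2` into `4`
  -- and works for every `σ ≥ 0`, without convexity.
  rcases le_total (bracketSq l) (bracketSq (k - l)) with h | h
  · calc bracketSq k ^ σ ≤ (4 * bracketSq (k - l)) ^ σ :=
          Real.rpow_le_rpow (bracketSq_pos k).le (by linarith) hσ
      _ = 4 ^ σ * bracketSq (k - l) ^ σ := Real.mul_rpow (by norm_num) (bracketSq_pos _).le
      _ ≤ _ := by gcongr; linarith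
  · calc bracketSq k ^ σ ≤ (4 * bracketSq l) ^ σ :=
          Real.rpow_le_rpow (bracketSq_pos k).le (by linarith) hσ
      _ = 4 ^ σ * bracketSq l ^ σ := Real.mul_rpow (by norm_num) (bracketSq_pos _).le
      _ ≤ _ := by gcongr; linarith

lemma summable_pi_prod {ι : Type*} {f : ι → ℝ} (hf : Summable f) (h0 : ∀ i, 0 ≤ f i) (n : ℕ) :
    Summable fun k : Fin n → ι => ∏ i, f (k i) := by
  induction n with
  | zero => exact Summable.of_finite
  | succ n ih =>
    rw [← (Fin.consEquiv fun _ : Fin (n + 1) => ι).summable_iff]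
    have := hf.mul_of_nonneg ih h0 fun k => Finset.prod_nonneg fun i _ => h0 _
    refine this.congr fun p => ?_
    simp [Fin.prod_univ_succ, Fin.consEquiv]

lemma summable_one_add_sq_rpow {r : ℝ} (hr : 1 / 2 < r) :
    Summable fun n : ℤ => (1 + (n : ℝ) ^ 2) ^ (-r) := by
  have h1 : Summable fun n : ℤ => |(n : ℝ)| ^ (-(2 * r)) :=
    Real.summable_abs_int_rpow (by linarith)
  refine Summable.of_norm_bounded_eventually h1 ?_
  filter_upwards [(Set.finite_singleton (0 : ℤ)).compl_mem_cofinite] with n hn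
  have hn : n ≠ 0 := hn
  have hp : 0 < |(n : ℝ)| := by positivity
  rw [Real.norm_of_nonneg (by positivity)]
  calc (1 + (n : ℝ) ^ 2) ^ (-r) ≤ (|(n : ℝ)| ^ 2) ^ (-r) :=
        Real.rpow_le_rpow_of_nonpos (by positivity) (by rw [sq_abs]; linarith) (by linarith)
    _ = _ := by
        rw [← Real.rpow_natCast, ← Real.rpow_mul hp.le]; congr 1; push_cast; ring

/-- Since `1 + |k|²` dominates each `1 + k_i²`, the term `(1 + |k|²)^(-σ)` is at most `∏ (1 +
k_i²)^(-σ/d)`. Each factor is summable over `ℤ` because `2σ/d > 1`. -/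
lemma summable_inv_sobolevWeight_sq (hd : 1 ≤ d) {σ : ℝ} (hσ : (d : ℝ) / 2 < σ) :
    Summable fun k : Fin d → ℤ => (sobolevWeight σ k ^ 2)⁻¹ := by
  have hd' : (0 : ℝ) < d := by exact_mod_cast hd
  have hr : 1 / 2 < σ / d := by rw [lt_div_iff₀ hd']; linarith
  refine (summable_pi_prod (summable_one_add_sq_rpow hr) (fun n => by positivity) d).of_nonneg_of_le
    (fun k => by positivity) fun k => ?_
  rw [sobolevWeight_sq, ← Real.rpow_neg (bracketSq_pos k).le]
  calc bracketSq k ^ (-σ) = ∏ _i : Fin d, bracketSq k ^ (-(σ / d)) := by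
        rw [Finset.prod_const, Finset.card_univ, Fintype.card_fin, ← Real.rpow_natCast,
          ← Real.rpow_mul (bracketSq_pos k).le]
        congr 1; field_simp
    _ ≤ _ := by
        refine Finset.prod_le_prod (fun i _ => Real.rpow_nonneg (bracketSq_pos k).le _) fun i _ => ?_
        refine Real.rpow_le_rpow_of_nonpos (by positivity) ?_ (by linarith)
        have : (k i : ℝ) ^ 2 ≤ ∑ i, (k i : ℝ) ^ 2 :=
          Finset.single_le_sum (f := fun i => (k i : ℝ) ^ 2) (fun i _ => sq_nonneg _)
            (Finset.mem_univ i)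
        unfold bracketSq; linarith

/-! ### Haar measure and orthogonality -/

instance : IsProbabilityMeasure (torusMeasure d) := by unfold torusMeasure; infer_instance

instance : Measure.IsAddHaarMeasure (torusMeasure d) := by unfold torusMeasure; infer_instance

lemma mFourierCoeff_def (f : UnitAddTorus (Fin d) → ℂ) (k : Fin d → ℤ) :
    mFourierCoeff f k = ∫ x, mFourier (-k) x * f x ∂torusMeasure d := rfl

section
-- The Hilbert basis of exponentials lives in `L²` of `volume`; with this instance `volume` on the
-- torus is `torusMeasure`.
local instance : MeasureSpace UnitAddCircle := ⟨AddCircle.haarAddCircle⟩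

lemma ae_eq_zero_of_mFourierCoeff_eq_zero {f : UnitAddTorus (Fin d) → ℂ}
    (hf : MemLp f 2 (torusMeasure d)) (h : ∀ k, mFourierCoeff f k = 0) :
    f =ᵐ[torusMeasure d] 0 := by
  have h0 (k : Fin d → ℤ) : mFourierCoeff (hf.toLp) k = 0 := by
    rw [← h k]
    refine integral_congr_ae ?_
    filter_upwards [hf.coeFn_toLp] with x hx
    rw [hx]
  have h1 : hf.toLp = 0 := by
    refine (mFourierBasis (d := Fin d)).repr.map_eq_zero_iff.mp (lp.ext (funext fun k => ?_))
    exact (mFourierBasis_repr hf.toLp k).trans (h0 k)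
  have h2 := hf.coeFn_toLp
  rw [h1] at h2
  exact h2.symm.trans (Lp.coeFn_zero ..)

lemma integral_mFourier_mul (k l : Fin d → ℤ) :
    ∫ x, mFourier (-k) x * mFourier l x ∂torusMeasure d = if k = l then 1 else 0 := by
  have := orthonormal_iff_ite.mp (orthonormal_mFourier (d := Fin d)) k l
  rw [ContinuousMap.inner_toLp] at this
  rw [← this]
  refine integral_congr_ae (ae_of_all _ fun x => ?_)
  simp only [mFourier_neg]
  ring
end

lemma norm_mFourier_apply (k : Fin d → ℤ) (x : UnitAddTorus (Fin d)) : ‖mFourier k x‖ = 1 := by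
  simp only [mFourier, ContinuousMap.coe_mk, norm_prod, fourier_apply, Circle.norm_coe,
    Finset.prod_const_one]

/-! ### Absolutely convergent Fourier series -/

/-- The Fourier series with coefficients `c`. -/
def wser (c : (Fin d → ℤ) → ℂ) (x : UnitAddTorus (Fin d)) : ℂ := ∑' k, c k * mFourier k x

lemma summable_wser {c : (Fin d → ℤ) → ℂ} (hc : Summable fun k => ‖c k‖)
    (x : UnitAddTorus (Fin d)) : Summable fun k => c k * mFourier k x := by
  refine Summable.of_norm ?_
  simpa [norm_mul, norm_mFourier_apply] using hc

lemma continuous_wser {c : (Fin d → ℤ) → ℂ} (hc : Summable fun k => ‖c k‖) :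
    Continuous (wser c) := by
  refine continuous_tsum (fun k => by fun_prop) hc fun k x => ?_
  rw [norm_mul, norm_mFourier_apply, mul_one]

lemma integral_mul_wser {c : (Fin d → ℤ) → ℂ} (hc : Summable fun k => ‖c k‖)
    {g : UnitAddTorus (Fin d) → ℂ} (hg : Continuous g) :
    ∫ x, g x * wser c x ∂torusMeasure d
      = ∑' k, c k * ∫ x, g x * mFourier k x ∂torusMeasure d := by
  obtain ⟨C, hC⟩ := isCompact_univ.exists_bound_of_continuousOn hg.continuousOn
  have hint (k) : Integrable (fun x => g x * (c k * mFourier k x)) (torusMeasure d) :=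
    (by fun_prop : Continuous fun x => g x * (c k * mFourier k x)).integrable_of_hasCompactSupport
      (HasCompactSupport.of_compactSpace _)
  have := integral_tsum_of_summable_integral_norm hint ?_
  · simp_rw [wser, ← tsum_mul_left, ← this]
    refine tsum_congr fun k => ?_
    rw [← integral_const_mul]
    congr 1; ext x; ring
  · refine (hc.mul_left C).of_nonneg_of_le (fun k => integral_nonneg fun x => norm_nonneg _)
      fun k => ?_
    have : ∀ x, ‖g x * (c k * mFourier k x)‖ ≤ C * ‖c k‖ := fun x => by
      rw [norm_mul, norm_mul, norm_mFourier_apply, mul_one]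
      gcongr
      exact hC x (mem_univ _)
    calc _ ≤ ∫ _x, C * ‖c k‖ ∂torusMeasure d :=
          integral_mono (hint k).norm (integrable_const _) this
      _ = _ := by simp

lemma mFourierCoeff_wser {c : (Fin d → ℤ) → ℂ} (hc : Summable fun k => ‖c k‖) (k : Fin d → ℤ) :
    mFourierCoeff (wser c) k = c k := by
  rw [mFourierCoeff_def, integral_mul_wser hc (by fun_prop), tsum_eq_single k]
  · simp [integral_mFourier_mul]
  · intro l hl
    rw [integral_mFourier_mul, if_neg hl.symm, mul_zero]

lemma wser_injective {c c' : (Fin d → ℤ) → ℂ} (hc : Summable fun k => ‖c k‖)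
    (hc' : Summable fun k => ‖c' k‖) (h : ∀ x, wser c x = wser c' x) : c = c' := by
  ext k
  rw [← mFourierCoeff_wser hc, ← mFourierCoeff_wser hc', funext h]

lemma conj_wser (c : (Fin d → ℤ) → ℂ) (x : UnitAddTorus (Fin d)) :
    conj (wser c x) = wser (fun k => conj (c (-k))) x := by
  simp only [wser, Complex.conj_tsum, map_mul, ← mFourier_neg]
  rw [← (Equiv.neg (Fin d → ℤ)).tsum_eq]
  simp

lemma wser_im_eq_zero_iff {c : (Fin d → ℤ) → ℂ} (hc : Summable fun k => ‖c k‖) :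
    (∀ x, (wser c x).im = 0) ↔ ∀ k, c (-k) = conj (c k) := by
  simp_rw [← Complex.conj_eq_iff_im, conj_wser]
  constructor
  · intro h k
    have hc' : Summable fun k => ‖conj (c (-k))‖ := by
      simpa [Function.comp_def] using (Equiv.neg (Fin d → ℤ)).summable_iff.mpr hc
    have := congrFun (wser_injective hc' hc h) k
    simpa using congrArg conj this
  · intro h x
    congr 1; ext k; rw [h, Complex.conj_conj]

lemma integral_conj_wser_mul_wser {c c' : (Fin d → ℤ) → ℂ} (hc : Summable fun k => ‖c k‖)
    (hc' : Summable fun k => ‖c' k‖) :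
    ∫ x, conj (wser c x) * wser c' x ∂torusMeasure d = ∑' k, conj (c k) * c' k := by
  have hcont := continuous_wser hc
  rw [integral_mul_wser hc' (by fun_prop)]
  refine tsum_congr fun k => ?_
  rw [mul_comm]
  congr 1
  rw [← mFourierCoeff_wser hc k, mFourierCoeff_def, ← integral_conj]
  congr 1; ext x
  rw [map_mul, mFourier_neg, Complex.conj_conj, mul_comm]

lemma wser_mul_wser {c c' : (Fin d → ℤ) → ℂ} (hc : Summable fun k => ‖c k‖)
    (hc' : Summable fun k => ‖c' k‖) (x : UnitAddTorus (Fin d)) :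
    wser c x * wser c' x = wser (fun k => ∑' l, c l * c' (k - l)) x := by
  have h1 : Summable fun k => ‖c k * mFourier k x‖ := (summable_wser hc x).norm
  have h2 : Summable fun k => ‖c' k * mFourier k x‖ := (summable_wser hc' x).norm
  rw [wser, wser, tsum_mul_tsum_of_summable_norm h1 h2]
  -- This shear groups the double series by total frequency `k`, producing the convolution.
  let e : (Fin d → ℤ) × (Fin d → ℤ) ≃ (Fin d → ℤ) × (Fin d → ℤ) :=
    { toFun := fun p => (p.2, p.1 - p.2)
      invFun := fun p => (p.1 + p.2, p.1)
      left_inv := fun p => by simp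
      right_inv := fun p => by simp }
  have h3 := summable_mul_of_summable_norm h1 h2
  have h4 := ((e.summable_iff).mpr h3).tsum_prod
  simp only [Function.comp_apply] at h4
  rw [← e.tsum_eq, h4, wser]
  refine tsum_congr fun k => ?_
  rw [← tsum_mul_right]
  refine tsum_congr fun l => ?_
  have : mFourier k x = mFourier l x * mFourier (k - l) x := by
    rw [← mFourier_add, add_sub_cancel]
  simp only [e, Equiv.coe_fn_mk, this]
  ring

/-! ### Derivatives of Fourier series -/

lemma mFourier_coe (k : Fin d → ℤ) (y : Fin d → ℝ) :
    mFourier k (fun i => (y i : UnitAddCircle))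
      = Complex.exp (2 * Real.pi * Complex.I * ∑ i, (k i : ℂ) * y i) := by
  simp only [mFourier, ContinuousMap.coe_mk, fourier_coe_apply, Finset.mul_sum, Complex.exp_sum]
  refine Finset.prod_congr rfl fun i _ => ?_
  congr 1; push_cast; ring

lemma mFourier_add_single (k : Fin d → ℤ) (x : UnitAddTorus (Fin d)) (i : Fin d) (h : ℝ) :
    mFourier k (x + Pi.single i (h : UnitAddCircle))
      = mFourier k x * Complex.exp (2 * Real.pi * Complex.I * k i * h) := by
  have hx : ∀ y z : UnitAddTorus (Fin d), mFourier k (y + z) = mFourier k y * mFourier k z := by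
    intro y z
    simp [mFourier, fourier_apply, Finset.prod_mul_distrib, AddCircle.toCircle_add]
  rw [hx]
  congr 1
  have : Pi.single i (h : UnitAddCircle)
      = fun j => (((Pi.single i h : Fin d → ℝ) j : ℝ) : UnitAddCircle) := by
    ext j; by_cases hj : j = i
    · subst hj; simp
    · simp [hj]
  rw [this, mFourier_coe]
  congr 1
  rw [Finset.sum_eq_single i]
  · simp; ring
  · intro j _ hj; simp [hj]
  · simp

/-- The Fourier symbol of `∂_i`. -/
def dsym (i : Fin d) (k : Fin d → ℤ) : ℂ := 2 * Real.pi * Complex.I * k i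

lemma norm_dsym (i : Fin d) (k : Fin d → ℤ) : ‖dsym i k‖ = 2 * Real.pi * |(k i : ℝ)| := by
  simp [dsym, abs_of_pos Real.pi_pos]

lemma hasDerivAt_wser {c : (Fin d → ℤ) → ℂ} {i : Fin d} (hc : Summable fun k => ‖c k‖)
    (hc' : Summable fun k => ‖dsym i k * c k‖) (x : UnitAddTorus (Fin d)) :
    HasDerivAt (fun h : ℝ => wser c (x + Pi.single i (h : UnitAddCircle)))
      (wser (fun k => dsym i k * c k) x) 0 := by
  have key : ∀ (k) (h : ℝ), HasDerivAt
      (fun h : ℝ => c k * mFourier k (x + Pi.single i (h : UnitAddCircle)))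
      (dsym i k * c k * mFourier k (x + Pi.single i (h : UnitAddCircle))) h := by
    intro k h
    simp only [mFourier_add_single]
    have h1 : HasDerivAt (fun h : ℝ => 2 * Real.pi * Complex.I * k i * (h : ℂ))
        (2 * Real.pi * Complex.I * k i * 1) h :=
      (Complex.ofRealCLM.hasDerivAt (x := h)).const_mul _
    have := (h1.cexp.const_mul (mFourier k x)).const_mul (c k)
    refine this.congr_deriv ?_
    simp only [dsym]; ring
  have := hasDerivAt_tsum hc' key (fun k h => by rw [norm_mul, norm_mFourier_apply, mul_one])
    (y₀ := 0) (summable_wser hc _) 0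
  simpa [wser] using this

/-- If a real function is given by a Fourier series, so is its partial derivative. -/
lemma ofReal_pderiv {c : (Fin d → ℤ) → ℂ} {i : Fin d} {f : UnitAddTorus (Fin d) → ℝ}
    (hc : Summable fun k => ‖c k‖) (hc' : Summable fun k => ‖dsym i k * c k‖)
    (hf : ∀ x, (f x : ℂ) = wser c x) (x : UnitAddTorus (Fin d)) :
    (pderiv i f x : ℂ) = wser (fun k => dsym i k * c k) x := by
  have h := hasDerivAt_wser hc hc' x
  simp only [← hf] at h
  have h1 : HasDerivAt (fun h : ℝ => f (x + Pi.single i (h : UnitAddCircle)))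
      (wser (fun k => dsym i k * c k) x).re 0 := by
    simpa [Function.comp_def] using Complex.reCLM.hasFDerivAt.comp_hasDerivAt (0 : ℝ) h
  have h2 := h.unique h1.ofReal_comp
  rw [h2, pderiv, h1.deriv]

lemma isCn_one_of_wser {c : (Fin d → ℤ) → ℂ} {f : UnitAddTorus (Fin d) → ℝ}
    (hc : Summable fun k => ‖c k‖) (hc' : ∀ i, Summable fun k => ‖dsym i k * c k‖)
    (hf : ∀ x, f x = (wser c x).re) : IsCn 1 f := by
  -- The derivative of the `k`-th term is `L k` times a unimodular factor, so its bound is uniform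
  -- in `y`.
  let L : (Fin d → ℤ) → (Fin d → ℝ) →L[ℝ] ℂ := fun k =>
    ∑ i, (ContinuousLinearMap.proj (R := ℝ) (φ := fun _ : Fin d => ℝ) i).smulRight (dsym i k * c k)
  have hL : ∀ k, ‖L k‖ ≤ ∑ i, ‖dsym i k * c k‖ := by
    intro k
    refine (norm_sum_le _ _).trans (Finset.sum_le_sum fun i _ => ?_)
    rw [ContinuousLinearMap.norm_smulRight_apply]
    refine mul_le_of_le_one_left (norm_nonneg _) ?_
    exact ContinuousLinearMap.opNorm_le_bound _ zero_le_one fun y => by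
      simpa using norm_le_pi_norm y i
  have hsum : Summable fun k => ∑ i, ‖dsym i k * c k‖ := summable_sum fun i _ => hc' i
  have key : ∀ k (y : Fin d → ℝ), HasFDerivAt
      (fun y : Fin d → ℝ => c k * mFourier k (fun i => (y i : UnitAddCircle)))
      (mFourier k (fun i => (y i : UnitAddCircle)) • L k) y := by
    intro k y
    simp only [mFourier_coe]
    have h1 : HasFDerivAt (fun y : Fin d → ℝ => 2 * Real.pi * Complex.I * ∑ i, (k i : ℂ) * y i)
        ((2 * Real.pi * Complex.I : ℂ) • ∑ i : Fin d, (k i : ℂ) • (Complex.ofRealCLM.comp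
          (ContinuousLinearMap.proj (R := ℝ) (φ := fun _ : Fin d => ℝ) i))) y := by
      refine HasFDerivAt.const_mul (HasFDerivAt.fun_sum fun i _ => ?_) _
      refine HasFDerivAt.const_mul ?_ _
      exact (Complex.ofRealCLM.comp
          (ContinuousLinearMap.proj (R := ℝ) (φ := fun _ : Fin d => ℝ) i)).hasFDerivAt
    refine (h1.cexp.const_mul (c k)).congr_fderiv ?_
    ext z
    simp [L, dsym, Finset.mul_sum]
    refine Finset.sum_congr rfl fun i _ => ?_
    ring
  have hder : ∀ y : Fin d → ℝ, HasFDerivAt (fun y : Fin d → ℝ =>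
      wser c (fun i => (y i : UnitAddCircle)))
      (∑' k, mFourier k (fun i => (y i : UnitAddCircle)) • L k) y := by
    intro y
    refine hasFDerivAt_tsum hsum key (fun k y => ?_) (x₀ := 0) (summable_wser hc _) y
    rw [norm_smul, norm_mFourier_apply, one_mul]
    exact hL k
  have hC : ContDiff ℝ 1 (fun y : Fin d → ℝ => wser c (fun i => (y i : UnitAddCircle))) := by
    rw [contDiff_one_iff_fderiv]
    refine ⟨fun y => (hder y).differentiableAt, ?_⟩
    have : fderiv ℝ (fun y : Fin d → ℝ => wser c (fun i => (y i : UnitAddCircle)))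
        = fun y => ∑' k, mFourier k (fun i => (y i : UnitAddCircle)) • L k :=
      funext fun y => (hder y).fderiv
    rw [this]
    refine continuous_tsum (fun k => ?_) hsum fun k y => ?_
    · refine Continuous.smul ((mFourier k).continuous.comp ?_) continuous_const
      exact continuous_pi fun i => (AddCircle.continuous_mk' 1).comp (continuous_apply i)
    · rw [norm_smul, norm_mFourier_apply, one_mul]
      exact hL k
  unfold IsCn
  simp only [hf]
  exact Complex.reCLM.contDiff.comp hC

/-- The range of exponents `σ > d / 2` for which `H^σ(𝕋^d)` is an algebra of continuous
functions. -/
structure Supercritical (d : ℕ) (σ : ℝ) : Prop where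
  one_le : 1 ≤ d
  lt : (d : ℝ) / 2 < σ

variable {σ : ℝ}

lemma Supercritical.nonneg (hσ : Supercritical d σ) : 0 ≤ σ :=
  le_trans (by positivity) hσ.lt.le

lemma Supercritical.mono {τ : ℝ} (hσ : Supercritical d σ) (h : σ ≤ τ) : Supercritical d τ :=
  ⟨hσ.one_le, hσ.lt.trans_le h⟩

lemma Supercritical.summable (hσ : Supercritical d σ) :
    Summable fun k : Fin d → ℤ => (sobolevWeight σ k ^ 2)⁻¹ :=
  summable_inv_sobolevWeight_sq hσ.one_le hσ.lt

/-! ### Square summable sequences -/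

lemma memℓp_two_iff {f : (Fin d → ℤ) → ℂ} :
    Memℓp f 2 ↔ Summable fun k => ‖f k‖ ^ 2 := by
  rw [memℓp_gen_iff (by norm_num)]
  norm_num

lemma CoeffSpace.summable_sq (F : CoeffSpace d) : Summable fun k => ‖F k‖ ^ 2 :=
  memℓp_two_iff.mp (lp.memℓp F)

lemma CoeffSpace.norm_sq (F : CoeffSpace d) : ‖F‖ ^ 2 = ∑' k, ‖F k‖ ^ 2 := by
  have := lp.norm_rpow_eq_tsum (p := 2) (by norm_num) F
  norm_num at this
  exact this

lemma tsum_mul_sq_le {ι : Type*} {a b : ι → ℝ} (ha : ∀ i, 0 ≤ a i) (hb : ∀ i, 0 ≤ b i)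
    (ha2 : Summable fun i => a i ^ 2) (hb2 : Summable fun i => b i ^ 2) :
    (Summable fun i => a i * b i) ∧
      (∑' i, a i * b i) ^ 2 ≤ (∑' i, a i ^ 2) * ∑' i, b i ^ 2 := by
  have := Real.summable_and_inner_le_Lp_mul_Lq_tsum_of_nonneg (p := 2) (q := 2)
    (by constructor <;> norm_num) ha hb (by simpa using ha2) (by simpa using hb2)
  refine ⟨this.1, ?_⟩
  have hle := this.2
  simp only [Real.rpow_two, ← Real.sqrt_eq_rpow] at hle
  calc (∑' i, a i * b i) ^ 2 ≤ (√(∑' i, a i ^ 2) * √(∑' i, b i ^ 2)) ^ 2 :=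
        pow_le_pow_left₀ (tsum_nonneg fun i => mul_nonneg (ha i) (hb i)) hle 2
    _ = _ := by
      rw [mul_pow, Real.sq_sqrt (tsum_nonneg fun i => sq_nonneg _),
        Real.sq_sqrt (tsum_nonneg fun i => sq_nonneg _)]

/-! ### Evaluation of Sobolev functions -/

/-- The Fourier coefficients of the element of `H^σ` with image `F` in `ℓ²`. -/
def wco (σ : ℝ) (F : CoeffSpace d) (k : Fin d → ℤ) : ℂ := F k / sobolevWeight σ k

/-- The Sobolev embedding: Cauchy–Schwarz against the square-summable inverse weights. -/
lemma summable_mul_wco (hσ : Supercritical d σ) (F : CoeffSpace d) :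
    Summable fun k => ‖wco σ F k‖ := by
  have := (tsum_mul_sq_le (fun k => norm_nonneg (F k)) (fun k => (inv_pos.mpr
    (sobolevWeight_pos σ k)).le) F.summable_sq (by simpa using hσ.summable)).1
  refine this.congr fun k => ?_
  rw [wco, norm_div, Complex.norm_real, Real.norm_of_nonneg (sobolevWeight_pos σ k).le,
    div_eq_mul_inv]

lemma wco_mul_weight (F : CoeffSpace d) (k : Fin d → ℤ) :
    sobolevWeight σ k * wco σ F k = F k := by
  have : (sobolevWeight σ k : ℂ) ≠ 0 := by exact_mod_cast (sobolevWeight_pos σ k).ne'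
  rw [wco]; field_simp

lemma wco_injective : Function.Injective (wco (d := d) σ) := by
  intro F G h
  ext k
  rw [← wco_mul_weight (σ := σ) F, h, wco_mul_weight]

/-- The evaluation at `x` of the element of `H^σ` with image `F` in `ℓ²`, as a continuous linear
functional of `F`. -/
def ev (hσ : Supercritical d σ) (x : UnitAddTorus (Fin d)) : CoeffSpace d →L[ℂ] ℂ :=
  innerSL ℂ (⟨fun k => conj (mFourier k x) / sobolevWeight σ k, memℓp_two_iff.mpr <| by
    refine hσ.summable.congr fun k => ?_
    rw [norm_div, RCLike.norm_conj, norm_mFourier_apply, Complex.norm_real, div_pow, one_pow,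
      one_div, Real.norm_eq_abs, sq_abs]⟩ : CoeffSpace d)

lemma ev_apply (hσ : Supercritical d σ) (x : UnitAddTorus (Fin d)) (F : CoeffSpace d) :
    ev hσ x F = wser (wco σ F) x := by
  rw [ev, innerSL_apply_apply, lp.inner_eq_tsum, wser]
  refine tsum_congr fun k => ?_
  simp only [wco, RCLike.inner_apply, map_div₀, Complex.conj_conj, Complex.conj_ofReal]
  ring

/-- Point evaluations separate `H^σ`, so operator identities below reduce to identities between
numbers. -/
lemma ev_injective (hσ : Supercritical d σ) {F G : CoeffSpace d}
    (h : ∀ x, ev hσ x F = ev hσ x G) : F = G := by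
  simp only [ev_apply] at h
  exact wco_injective (wser_injective (summable_mul_wco hσ F) (summable_mul_wco hσ G) h)

lemma continuous_ev (hσ : Supercritical d σ) (F : CoeffSpace d) :
    Continuous fun x => ev hσ x F := by
  simp only [ev_apply]
  exact continuous_wser (summable_mul_wco hσ F)

/-! ### Fourier multipliers -/

/-- The Fourier multiplier with a bounded symbol. -/
def diag (m : (Fin d → ℤ) → ℂ) {C : ℝ} (hm : ∀ k, ‖m k‖ ≤ C) : CoeffSpace d →L[ℂ] CoeffSpace d :=
  lp.mapCLM 2 (fun k => m k • ContinuousLinearMap.id ℂ ℂ) (K := C)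
    ((norm_nonneg _).trans (hm 0)) fun k => by
      rw [norm_smul, ContinuousLinearMap.norm_id, mul_one]; exact hm k

lemma diag_apply (m : (Fin d → ℤ) → ℂ) {C : ℝ} (hm : ∀ k, ‖m k‖ ≤ C) (F : CoeffSpace d)
    (k : Fin d → ℤ) : diag m hm F k = m k * F k := by
  simp [diag]

lemma norm_diag_le (m : (Fin d → ℤ) → ℂ) {C : ℝ} (hm : ∀ k, ‖m k‖ ≤ C) : ‖diag m hm‖ ≤ C :=
  lp.norm_mapCLM_le ..

/-- The finite-rank truncations `T s` converge in norm, the error being a multiplier whose symbol is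
small off a finite set. -/
lemma isCompactOperator_diag {m : (Fin d → ℤ) → ℂ} {C : ℝ} (hm : ∀ k, ‖m k‖ ≤ C)
    (h0 : Filter.Tendsto m Filter.cofinite (nhds 0)) : IsCompactOperator (diag m hm) := by
  classical
  let T : Finset (Fin d → ℤ) → CoeffSpace d →L[ℂ] CoeffSpace d := fun s =>
    ∑ k ∈ s, (lp.singleContinuousLinearMap ℂ (fun _ : Fin d → ℤ => ℂ) 2 k).comp
      (m k • lp.evalCLM ℂ (fun _ : Fin d → ℤ => ℂ) 2 k)
  have hT : ∀ s, IsCompactOperator (T s) := by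
    intro s
    induction s using Finset.induction_on with
    | empty => exact isCompactOperator_zero
    | insert k s hk ih =>
      simp only [T, Finset.sum_insert hk]
      have h := (isCompactOperator_of_locallyCompactSpace_dom
        (m k • lp.evalCLM ℂ (fun _ : Fin d → ℤ => ℂ) 2 k)).clm_comp
        (lp.singleContinuousLinearMap ℂ (fun _ : Fin d → ℤ => ℂ) 2 k)
      exact IsCompactOperator.add h ih
  have hTapp : ∀ s F k, (T s F) k = if k ∈ s then m k * F k else 0 := by
    intro s F k
    simp only [T, sum_apply, lp.coeFn_sum, Finset.sum_apply]
    simp [Pi.single_apply]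
    rfl
  refine isCompactOperator_of_tendsto (l := Filter.atTop) (F := T) ?_ (.of_forall hT)
  rw [Metric.tendsto_atTop]
  intro ε hε
  have hfin : {k | ¬ ‖m k‖ < ε / 2}.Finite := by
    have := (Metric.tendsto_nhds.mp h0) (ε / 2) (by positivity)
    simpa [Filter.eventually_cofinite] using this
  refine ⟨hfin.toFinset, fun s hs => ?_⟩
  have hm' : ∀ k, ‖(if k ∈ s then 0 else - m k)‖ ≤ ε / 2 := by
    intro k
    split_ifs with hk
    · simp; positivity
    · rw [norm_neg]
      by_contra hcon
      exact hk (hs (by simpa using le_of_lt (not_le.mp hcon)))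
  have : T s - diag m hm = diag _ hm' := by
    ext F k
    simp only [sub_apply, lp.coeFn_sub, Pi.sub_apply, hTapp, diag_apply]
    split_ifs <;> ring
  rw [dist_eq_norm, this]
  exact (norm_diag_le _ hm').trans_lt (by linarith)

/-! ### Multiplication in Sobolev spaces -/

lemma summable_convolution {c c' : (Fin d → ℤ) → ℂ} (hc : Summable fun k => ‖c k‖)
    (hc' : Summable fun k => ‖c' k‖) (k : Fin d → ℤ) : Summable fun l => c l * c' (k - l) := by
  have := summable_mul_of_summable_norm hc hc'
  exact this.comp_injective (i := fun l : Fin d → ℤ => (l, k - l)) fun l l' h =>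
    (Prod.mk.inj h).1

/-- The coordinates of a product of two elements of `H^σ`. -/
def mulCoeff (σ : ℝ) (F G : CoeffSpace d) (k : Fin d → ℤ) : ℂ :=
  sobolevWeight σ k * ∑' l, wco σ F l * wco σ G (k - l)

/-- A bound for the norm of the multiplication of `H^σ`. -/
def mulConst (d : ℕ) (σ : ℝ) : ℝ :=
  2 * 4 ^ σ * ∑' k : Fin d → ℤ, (sobolevWeight σ k ^ 2)⁻¹

lemma mulConst_nonneg (d : ℕ) (σ : ℝ) : 0 ≤ mulConst d σ :=
  mul_nonneg (by positivity) (tsum_nonneg fun k => by positivity)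

/-- Cauchy–Schwarz separates the weights `a` from the coefficients `b`. Peetre's inequality bounds
`a l ^ 2` by translates of the inverse squared weights, whose sum does not depend on `k`. -/
lemma norm_mulCoeff_sq_le (hσ : Supercritical d σ) (F G : CoeffSpace d) (k : Fin d → ℤ) :
    (Summable fun l => ‖F l‖ ^ 2 * ‖G (k - l)‖ ^ 2) ∧
    ‖mulCoeff σ F G k‖ ^ 2 ≤ mulConst d σ * ∑' l, ‖F l‖ ^ 2 * ‖G (k - l)‖ ^ 2 := by
  have hw := fun l : Fin d → ℤ => sobolevWeight_pos σ l
  let a : (Fin d → ℤ) → ℝ := fun l =>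
    sobolevWeight σ k / (sobolevWeight σ l * sobolevWeight σ (k - l))
  let b : (Fin d → ℤ) → ℝ := fun l => ‖F l‖ * ‖G (k - l)‖
  have ha0 : ∀ l, 0 ≤ a l := fun l =>
    div_nonneg (hw _).le (mul_nonneg (hw _).le (hw _).le)
  have hb0 : ∀ l, 0 ≤ b l := fun l => by positivity
  have hS := hσ.summable
  have hS' : Summable fun l : Fin d → ℤ => (sobolevWeight σ (k - l) ^ 2)⁻¹ :=
    (Equiv.subLeft k).summable_iff.mpr hS
  have hS'' : ∑' l : Fin d → ℤ, (sobolevWeight σ (k - l) ^ 2)⁻¹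
      = ∑' l : Fin d → ℤ, (sobolevWeight σ l ^ 2)⁻¹ :=
    (Equiv.subLeft k).tsum_eq fun l => (sobolevWeight σ l ^ 2)⁻¹
  have hale : ∀ l, a l ^ 2
      ≤ 4 ^ σ * ((sobolevWeight σ (k - l) ^ 2)⁻¹ + (sobolevWeight σ l ^ 2)⁻¹) := by
    intro l
    have h := sobolevWeight_sq_le hσ.nonneg k l
    have h1 := hw l
    have h2 := hw (k - l)
    simp only [a, div_pow, mul_pow]
    rw [div_le_iff₀ (by positivity)]
    refine h.trans_eq ?_
    field_simp
  have hsum : Summable fun l =>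
      4 ^ σ * ((sobolevWeight σ (k - l) ^ 2)⁻¹ + (sobolevWeight σ l ^ 2)⁻¹) :=
    (hS'.add hS).mul_left _
  have ha2 : Summable fun l => a l ^ 2 := hsum.of_nonneg_of_le (fun l => sq_nonneg _) hale
  have hb2' : Summable fun l => ‖F l‖ ^ 2 * ‖G (k - l)‖ ^ 2 := by
    have := (F.summable_sq).mul_of_nonneg G.summable_sq (fun l => sq_nonneg _)
      (fun l => sq_nonneg _)
    exact this.comp_injective (i := fun l : Fin d → ℤ => (l, k - l)) fun l l' h =>
      (Prod.mk.inj h).1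
  have hb2 : Summable fun l => b l ^ 2 := by simpa only [b, mul_pow] using hb2'
  obtain ⟨hab, hle⟩ := tsum_mul_sq_le ha0 hb0 ha2 hb2
  refine ⟨hb2', ?_⟩
  have hnorm : ‖mulCoeff σ F G k‖ ≤ ∑' l, a l * b l := by
    rw [mulCoeff, ← tsum_mul_left]
    refine tsum_of_norm_bounded hab.hasSum fun l => le_of_eq ?_
    simp only [norm_mul, wco, norm_div, Complex.norm_real, Real.norm_of_nonneg (hw _).le, a, b]
    field_simp
  calc ‖mulCoeff σ F G k‖ ^ 2 ≤ (∑' l, a l * b l) ^ 2 :=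
        pow_le_pow_left₀ (norm_nonneg _) hnorm 2
    _ ≤ (∑' l, a l ^ 2) * ∑' l, b l ^ 2 := hle
    _ ≤ mulConst d σ * ∑' l, b l ^ 2 := by
        refine mul_le_mul_of_nonneg_right ?_ (tsum_nonneg fun l => sq_nonneg _)
        refine (ha2.tsum_le_tsum hale hsum).trans_eq ?_
        rw [tsum_mul_left, hS'.tsum_add hS, hS'', mulConst]
        ring
    _ = _ := by simp only [b, mul_pow]

/-- Summing the previous bound over `k`, the convolution of `‖F‖²` with `‖G‖²` has total mass equal
to the product of the masses. -/
lemma summable_norm_mulCoeff_sq (hσ : Supercritical d σ) (F G : CoeffSpace d) :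
    (Summable fun k => ‖mulCoeff σ F G k‖ ^ 2) ∧
    ∑' k, ‖mulCoeff σ F G k‖ ^ 2 ≤ mulConst d σ * (‖F‖ ^ 2 * ‖G‖ ^ 2) := by
  let e : (Fin d → ℤ) × (Fin d → ℤ) ≃ (Fin d → ℤ) × (Fin d → ℤ) :=
    { toFun := fun p => (p.2, p.1 - p.2)
      invFun := fun p => (p.1 + p.2, p.1)
      left_inv := fun p => by simp
      right_inv := fun p => by simp }
  have h1 := (F.summable_sq).mul_of_nonneg G.summable_sq (fun l => sq_nonneg _)
      (fun l => sq_nonneg _)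
  have h2 : Summable fun p : (Fin d → ℤ) × (Fin d → ℤ) => ‖F p.2‖ ^ 2 * ‖G (p.1 - p.2)‖ ^ 2 :=
    e.summable_iff.mpr h1
  have h3 : ∑' k, ∑' l, ‖F l‖ ^ 2 * ‖G (k - l)‖ ^ 2 = ‖F‖ ^ 2 * ‖G‖ ^ 2 := by
    rw [F.norm_sq, G.norm_sq, F.summable_sq.tsum_mul_tsum G.summable_sq h1, ← e.tsum_eq,
      ← h2.tsum_prod]
    rfl
  have h4 := h2.prod.mul_left (mulConst d σ)
  have h5 := fun k => (norm_mulCoeff_sq_le hσ F G k).2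
  have h6 := h4.of_nonneg_of_le (fun k => sq_nonneg _) h5
  refine ⟨h6, (h6.tsum_le_tsum h5 h4).trans_eq ?_⟩
  rw [tsum_mul_left, h3]

/-- Multiplication of `H^σ`, in coordinates. -/
def mulS (hσ : Supercritical d σ) : CoeffSpace d →L[ℂ] CoeffSpace d →L[ℂ] CoeffSpace d :=
  LinearMap.mkContinuous₂
    (LinearMap.mk₂ ℂ (fun F G : CoeffSpace d =>
        (⟨mulCoeff σ F G, memℓp_two_iff.mpr (summable_norm_mulCoeff_sq hσ F G).1⟩ : CoeffSpace d))
      (fun F F' G => by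
        ext k
        have h1 := summable_convolution (summable_mul_wco hσ F) (summable_mul_wco hσ G) k
        have h2 := summable_convolution (summable_mul_wco hσ F') (summable_mul_wco hσ G) k
        simp only [mulCoeff, lp.coeFn_add, Pi.add_apply, ← mul_add, ← h1.tsum_add h2]
        congr 2; ext l; simp only [wco, lp.coeFn_add, Pi.add_apply]; ring)
      (fun c F G => by
        ext k
        simp only [mulCoeff, lp.coeFn_smul, Pi.smul_apply, smul_eq_mul, mul_left_comm c,
          ← tsum_mul_left (a := c)]
        congr 2; ext l; simp only [wco, lp.coeFn_smul, Pi.smul_apply, smul_eq_mul]; ring)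
      (fun F G G' => by
        ext k
        have h1 := summable_convolution (summable_mul_wco hσ F) (summable_mul_wco hσ G) k
        have h2 := summable_convolution (summable_mul_wco hσ F) (summable_mul_wco hσ G') k
        simp only [mulCoeff, lp.coeFn_add, Pi.add_apply, ← mul_add, ← h1.tsum_add h2]
        congr 2; ext l; simp only [wco, lp.coeFn_add, Pi.add_apply]; ring)
      (fun c F G => by
        ext k
        simp only [mulCoeff, lp.coeFn_smul, Pi.smul_apply, smul_eq_mul, mul_left_comm c,
          ← tsum_mul_left (a := c)]
        congr 2; ext l; simp only [wco, lp.coeFn_smul, Pi.smul_apply, smul_eq_mul]; ring))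
    (√(mulConst d σ)) fun F G => by
      refine abs_le_of_sq_le_sq' ?_ (by positivity) |>.2
      rw [CoeffSpace.norm_sq, mul_pow, mul_pow, Real.sq_sqrt (mulConst_nonneg d σ), mul_assoc]
      exact (summable_norm_mulCoeff_sq hσ F G).2

lemma ev_mulS (hσ : Supercritical d σ) (F G : CoeffSpace d) (x : UnitAddTorus (Fin d)) :
    ev hσ x (mulS hσ F G) = ev hσ x F * ev hσ x G := by
  simp only [ev_apply, wser_mul_wser (summable_mul_wco hσ F) (summable_mul_wco hσ G)]
  congr 1
  ext k
  have : (sobolevWeight σ k : ℂ) ≠ 0 := by exact_mod_cast (sobolevWeight_pos σ k).ne'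
  change mulCoeff σ F G k / _ = _
  rw [mulCoeff]; field_simp

lemma commute_mulS (hσ : Supercritical d σ) (F G : CoeffSpace d) :
    Commute (mulS hσ F) (mulS hσ G) := by
  refine ContinuousLinearMap.ext fun X => ev_injective hσ fun x => ?_
  simp only [mul_apply_eq_comp, ev_mulS]
  ring

/-- The constant function `1`, in coordinates. -/
def oneS (d : ℕ) : CoeffSpace d := lp.single 2 0 1

lemma ev_oneS (hσ : Supercritical d σ) (x : UnitAddTorus (Fin d)) : ev hσ x (oneS d) = 1 := by
  rw [ev_apply, wser, tsum_eq_single 0]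
  · simp [wco, oneS, sobolevWeight_zero_right, mFourier_zero]
  · intro k hk
    simp [wco, oneS, hk]

/-! ### Exponentials of multiplication operators -/

lemma continuous_exp_of_complex (A : Type*) [NormedRing A] [NormedAlgebra ℂ A] [CompleteSpace A] :
    Continuous (NormedSpace.exp : A → A) := by
  let _ : NormedAlgebra ℚ A := .restrictScalars ℚ ℂ A
  exact NormedSpace.exp_continuous

/-- In a noncommutative algebra the derivative of `exp` is not a plain product. On the commuting
range of `L`, however, `exp (L x) = exp (L a) * exp (L (x - a))`, which reduces the claim to the
derivative of `exp` at `0`. -/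
lemma hasStrictFDerivAt_exp_comp {E A : Type*} [NormedAddCommGroup E] [NormedSpace ℂ E]
    [NormedRing A] [NormedAlgebra ℂ A] [CompleteSpace A] (L : E →L[ℂ] A)
    (hL : ∀ x y, Commute (L x) (L y)) (a : E) :
    HasStrictFDerivAt (fun x => NormedSpace.exp (L x))
      ((ContinuousLinearMap.mul ℂ A (NormedSpace.exp (L a))).comp L) a := by
  let _ : NormedAlgebra ℚ A := .restrictScalars ℚ ℂ A
  have h0 : HasStrictFDerivAt (NormedSpace.exp : A → A) (1 : A →L[ℂ] A) (L (a - a)) := by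
    rw [sub_self, map_zero]; exact hasStrictFDerivAt_exp_zero
  have h1 : HasStrictFDerivAt (fun x => L (x - a)) L a :=
    L.hasStrictFDerivAt.comp a ((hasStrictFDerivAt_id a).sub_const a)
  have h2 := (ContinuousLinearMap.mul ℂ A (NormedSpace.exp (L a))).hasStrictFDerivAt.comp a
    (h0.comp a h1)
  have h3 : (fun x => NormedSpace.exp (L x))
      = fun x => NormedSpace.exp (L a) * NormedSpace.exp (L (x - a)) := by
    ext1 x
    rw [← NormedSpace.exp_add_of_commute (hL a (x - a)), ← map_add, add_sub_cancel]
  rw [h3]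
  exact h2

/-- Multiplication by the exponential of an element of `H^σ`, in coordinates. -/
def expS (hσ : Supercritical d σ) (F : CoeffSpace d) : CoeffSpace d →L[ℂ] CoeffSpace d :=
  NormedSpace.exp (mulS hσ F)

/-- Evaluation at `x` is continuous and multiplicative, so it carries the operator exponential
series to the scalar one. -/
lemma ev_expS (hσ : Supercritical d σ) (F G : CoeffSpace d) (x : UnitAddTorus (Fin d)) :
    ev hσ x (expS hσ F G) = Complex.exp (ev hσ x F) * ev hσ x G := by
  have h1 := NormedSpace.exp_series_hasSum_exp' (𝕂 := ℂ) (mulS hσ F)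
  have h2 := ((ev hσ x).comp (ContinuousLinearMap.apply ℂ (CoeffSpace d) G)).hasSum h1
  have h3 : HasSum (fun n : ℕ => ((n.factorial : ℂ)⁻¹ • (ev hσ x F) ^ n) * ev hσ x G)
      (Complex.exp (ev hσ x F) * ev hσ x G) := by
    rw [Complex.exp_eq_exp_ℂ]
    exact (NormedSpace.exp_series_hasSum_exp' (𝕂 := ℂ) (ev hσ x F)).mul_right _
  refine h2.unique ?_
  convert h3 using 2 with n
  have hpow : ∀ n : ℕ, ev hσ x ((mulS hσ F ^ n) G) = ev hσ x F ^ n * ev hσ x G := by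
    intro n
    induction n with
    | zero => simp
    | succ n ih => rw [pow_succ', mul_apply_eq_comp, ev_mulS, ih]; ring
  change ev hσ x (((n.factorial : ℂ)⁻¹ • mulS hσ F ^ n) G) = _
  rw [smul_apply, map_smul, hpow, smul_eq_mul, smul_eq_mul, mul_assoc]

lemma continuous_expS (hσ : Supercritical d σ) : Continuous (expS hσ) :=
  (continuous_exp_of_complex _).comp (mulS hσ).continuous

lemma hasStrictFDerivAt_expS (hσ : Supercritical d σ) (F : CoeffSpace d) :
    HasStrictFDerivAt (expS hσ)
      ((ContinuousLinearMap.mul ℂ (CoeffSpace d →L[ℂ] CoeffSpace d) (expS hσ F)).comp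
        (mulS hσ)) F :=
  hasStrictFDerivAt_exp_comp (mulS hσ) (commute_mulS hσ) F

/-! ### From weak to strong differentiability -/

/-- A curve in a Banach space whose images under a separating family of functionals have the
derivatives prescribed by a continuous curve is differentiable. -/
lemma hasDerivAt_of_separating {E ι : Type*} [NormedAddCommGroup E] [NormedSpace ℝ E]
    [CompleteSpace E] (L : ι → E →L[ℝ] ℂ) (hL : ∀ v w, (∀ i, L i v = L i w) → v = w)
    {a b : ℝ} {F N : ℝ → E} (hN : ContinuousOn N (Ioo a b))
    (h : ∀ t ∈ Ioo a b, ∀ i, HasDerivAt (fun τ => L i (F τ)) (L i (N t)) t)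
    {t₀ : ℝ} (ht₀ : t₀ ∈ Ioo a b) : HasDerivAt F (N t₀) t₀ := by
  -- Every functional `L i` sees `F - P` as constant on the interval, so separation gives `F = F t₀
  -- + P`, and `P` is differentiable by the fundamental theorem of calculus.
  let P : ℝ → E := fun t => ∫ τ in t₀..t, N τ
  have hsub : ∀ t ∈ Ioo a b, uIcc t₀ t ⊆ Ioo a b := fun t ht =>
    (ordConnected_Ioo).uIcc_subset ht₀ ht
  have hP : ∀ t ∈ Ioo a b, HasDerivAt P (N t) t := by
    intro t ht
    refine intervalIntegral.integral_hasDerivAt_right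
      ((hN.mono (hsub t ht)).intervalIntegrable) ?_ ?_
    · exact hN.stronglyMeasurableAtFilter isOpen_Ioo t ht
    · exact hN.continuousAt (isOpen_Ioo.mem_nhds ht)
  have hF : ∀ t ∈ Ioo a b, F t = F t₀ + P t := by
    intro t ht
    refine hL _ _ fun i => ?_
    have hd : ∀ s ∈ Ioo a b, HasDerivAt (fun τ => L i (F τ) - L i (P τ)) 0 s := fun s hs => by
      simpa [Function.comp_def, Pi.sub_def] using
        (h s hs i).sub ((L i).hasFDerivAt.comp_hasDerivAt s (hP s hs))
    have := isOpen_Ioo.is_const_of_deriv_eq_zero isPreconnected_Ioo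
      (fun s hs => (hd s hs).differentiableAt.differentiableWithinAt)
      (fun s hs => (hd s hs).deriv) ht ht₀
    have hP0 : P t₀ = 0 := intervalIntegral.integral_same
    simp only [hP0, map_zero, sub_zero] at this
    rw [map_add, ← this, sub_add_cancel]
  refine ((hP t₀ ht₀).const_add (F t₀)).congr_of_eventuallyEq ?_
  filter_upwards [isOpen_Ioo.mem_nhds ht₀] with t ht using hF t ht

/-! ### The symbol of the Laplacian -/

/-- The Fourier symbol of `-Δ`. -/
def lapSym (k : Fin d → ℤ) : ℝ := 4 * Real.pi ^ 2 * ∑ i, (k i : ℝ) ^ 2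

lemma lapSym_nonneg (k : Fin d → ℤ) : 0 ≤ lapSym k :=
  mul_nonneg (by positivity) (Finset.sum_nonneg fun i _ => sq_nonneg _)

lemma sum_dsym_mul_self (k : Fin d → ℤ) : ∑ i, dsym i k * dsym i k = -(lapSym k : ℂ) := by
  simp only [lapSym, dsym]
  push_cast
  rw [Finset.mul_sum, ← Finset.sum_neg_distrib]
  refine Finset.sum_congr rfl fun i _ => ?_
  linear_combination (4 * (Real.pi : ℂ) ^ 2 * (k i : ℂ) ^ 2) * Complex.I_sq

lemma bracketSq_le_one_add_lapSym (k : Fin d → ℤ) : bracketSq k ≤ 1 + lapSym k := by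
  have h0 : 0 ≤ ∑ i, (k i : ℝ) ^ 2 := Finset.sum_nonneg fun i _ => sq_nonneg _
  have hpi : 2 ≤ 4 * Real.pi ^ 2 := by nlinarith [Real.pi_gt_three]
  unfold bracketSq lapSym
  nlinarith [mul_le_mul_of_nonneg_right hpi h0]

lemma bracketSq_le_lapSym {k : Fin d → ℤ} (hk : k ≠ 0) : bracketSq k ≤ lapSym k := by
  have h0 : 0 ≤ ∑ i, (k i : ℝ) ^ 2 := Finset.sum_nonneg fun i _ => sq_nonneg _
  have h : 1 ≤ ∑ i, (k i : ℝ) ^ 2 := by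
    obtain ⟨i, hi⟩ := Function.ne_iff.mp hk
    have h1 : (1 : ℝ) ≤ (k i : ℝ) ^ 2 := by
      have : (1 : ℤ) ≤ (k i) ^ 2 := Int.add_one_le_of_lt (sq_pos_of_ne_zero hi)
      exact_mod_cast this
    exact h1.trans (Finset.single_le_sum (f := fun i => (k i : ℝ) ^ 2)
      (fun i _ => sq_nonneg _) (Finset.mem_univ i))
  -- For `|k|² ≥ 1`, the bound `2` suffices: `1 + |k|² ≤ 2|k|² ≤ 4π²|k|²`.
  have hpi : 2 ≤ 4 * Real.pi ^ 2 := by nlinarith [Real.pi_gt_three]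
  unfold bracketSq lapSym
  nlinarith [mul_le_mul_of_nonneg_right hpi h0]

lemma one_add_lapSym_ne_zero (k : Fin d → ℤ) : (1 + lapSym k : ℂ) ≠ 0 := by
  have := lapSym_nonneg k
  exact_mod_cast (by linarith : (1 + lapSym k : ℝ) ≠ 0)

lemma norm_one_add_lapSym (k : Fin d → ℤ) : ‖(1 + lapSym k : ℂ)‖ = 1 + lapSym k := by
  have := lapSym_nonneg k
  rw [← Complex.ofReal_one, ← Complex.ofReal_add, Complex.norm_real, Real.norm_of_nonneg]
  linarith

lemma norm_resolvent_le_one (k : Fin d → ℤ) : ‖(1 + lapSym k : ℂ)⁻¹‖ ≤ 1 := by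
  rw [norm_inv, norm_one_add_lapSym]
  exact inv_le_one_of_one_le₀ (by linarith [lapSym_nonneg k])

/-- The summable family `(1 + |k|²)^(-σ)` tends to zero; take its power `1/σ`. -/
lemma tendsto_inv_bracketSq (hσ : Supercritical d σ) :
    Filter.Tendsto (fun k : Fin d → ℤ => (bracketSq k)⁻¹) Filter.cofinite (nhds 0) := by
  have hσ0 : 0 < σ := by
    have h1 := hσ.one_le
    have h2 : (0 : ℝ) < d := by exact_mod_cast h1
    linarith [hσ.lt]
  have h := hσ.summable.tendsto_cofinite_zero.rpow_const (p := 1 / σ) (Or.inr (by positivity))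
  rw [Real.zero_rpow (by positivity)] at h
  refine h.congr fun k => ?_
  rw [sobolevWeight_sq, Real.inv_rpow (Real.rpow_nonneg (bracketSq_pos k).le _),
    ← Real.rpow_mul (bracketSq_pos k).le, mul_one_div_cancel hσ0.ne', Real.rpow_one]

/-- The resolvent `(1 - Δ)⁻¹`. -/
def resolv (d : ℕ) : CoeffSpace d →L[ℂ] CoeffSpace d :=
  diag (fun k => (1 + lapSym k : ℂ)⁻¹) norm_resolvent_le_one

lemma resolv_apply (F : CoeffSpace d) (k : Fin d → ℤ) :
    resolv d F k = (1 + lapSym k : ℂ)⁻¹ * F k := diag_apply ..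

lemma isCompactOperator_resolv (hσ : Supercritical d σ) : IsCompactOperator (resolv d) := by
  refine isCompactOperator_diag _ ?_
  refine squeeze_zero_norm (fun k => ?_) (tendsto_inv_bracketSq hσ)
  rw [norm_inv, norm_one_add_lapSym]
  exact inv_anti₀ (bracketSq_pos k) (bracketSq_le_one_add_lapSym k)

/-! ### The linearized Poisson operator -/

/-- The operator `(1 - Δ)⁻¹ (-Δ + e^F)` on `H^σ`. -/
def ellip (hσ : Supercritical d σ) (F : CoeffSpace d) : CoeffSpace d →L[ℂ] CoeffSpace d :=
  1 + resolv d * (expS hσ F - 1)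

lemma continuous_ellip (hσ : Supercritical d σ) : Continuous (ellip hσ) := by
  have := continuous_expS hσ
  unfold ellip
  fun_prop

/-- The hypothesis says `-Δv + e^F v = 0`. Pairing with `v` through Parseval gives `∫ e^F |v|² = -∑
4π²|k|² |v̂(k)|² ≤ 0`. As `F` is real, `e^F > 0`, so the continuous function `v` vanishes. -/
lemma eq_zero_of_ellip_eq_zero (hσ : Supercritical d σ) {F : CoeffSpace d}
    (hF : ∀ x, (ev hσ x F).im = 0) {v : CoeffSpace d}
    (hv : resolv d (v - expS hσ F v) = v) : v = 0 := by
  set c := wco σ v with hc_def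
  have hc := summable_mul_wco hσ v
  have hc' := summable_mul_wco hσ (expS hσ F v)
  have hco : ∀ k, wco σ (expS hσ F v) k = -lapSym k * c k := by
    intro k
    have h1 : (1 + lapSym k : ℂ)⁻¹ * (v k - expS hσ F v k) = v k := by
      have := resolv_apply (v - expS hσ F v) k
      rw [hv] at this
      exact this.symm
    have h2 : expS hσ F v k = -lapSym k * v k := by
      have := one_add_lapSym_ne_zero k
      field_simp at h1
      linear_combination -h1
    simp only [hc_def, wco, h2]
    ring
  have hev : ∀ x, ev hσ x F = ((ev hσ x F).re : ℂ) := fun x =>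
    Complex.ext (by simp) (by simp [hF])
  have hI := integral_conj_wser_mul_wser hc hc'
  have hpt : ∀ x, conj (wser c x) * wser (wco σ (expS hσ F v)) x
      = ((Real.exp (ev hσ x F).re * ‖wser c x‖ ^ 2 : ℝ) : ℂ) := by
    intro x
    rw [← ev_apply hσ x (expS hσ F v), ev_expS, hev, ev_apply hσ x v, ← hc_def]
    push_cast
    rw [← Complex.conj_mul', Complex.ofReal_re]
    ring
  have hterm : ∀ k, conj (c k) * wco σ (expS hσ F v) k
      = ((-(lapSym k * ‖c k‖ ^ 2) : ℝ) : ℂ) := by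
    intro k
    rw [hco]
    push_cast
    rw [← Complex.conj_mul']
    ring
  simp only [← hc_def, hpt, hterm] at hI
  rw [integral_complex_ofReal, ← Complex.ofReal_tsum] at hI
  have hI' := Complex.ofReal_injective hI
  have hcontR : Continuous fun x => (ev hσ x F).re :=
    Complex.continuous_re.comp (continuous_ev hσ F)
  have hcont : Continuous fun x => Real.exp (ev hσ x F).re * ‖wser c x‖ ^ 2 := by
    have := continuous_wser hc
    fun_prop
  have hnn : ∀ x, 0 ≤ Real.exp (ev hσ x F).re * ‖wser c x‖ ^ 2 := fun x => by positivity
  have hle : ∫ x, Real.exp (ev hσ x F).re * ‖wser c x‖ ^ 2 ∂torusMeasure d ≤ 0 := by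
    rw [hI', tsum_neg, neg_nonpos]
    exact tsum_nonneg fun k => mul_nonneg (lapSym_nonneg k) (sq_nonneg _)
  have hzero : ∫ x, Real.exp (ev hσ x F).re * ‖wser c x‖ ^ 2 ∂torusMeasure d = 0 :=
    le_antisymm hle (integral_nonneg hnn)
  have hint := hcont.integrable_of_hasCompactSupport (μ := torusMeasure d)
    (HasCompactSupport.of_compactSpace _)
  have hae := (integral_eq_zero_iff_of_nonneg hnn hint).mp hzero
  have heq := hcont.ae_eq_iff_eq (torusMeasure d) continuous_zero |>.mp hae
  refine ev_injective hσ fun x => ?_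
  have := congrFun heq x
  simp only [Pi.zero_apply, mul_eq_zero, (Real.exp_pos _).ne', false_or] at this
  rw [map_zero, ev_apply]
  simpa using this

/-- Fredholm alternative for the compact operator `(1-Δ)⁻¹(1 - e^F)` at the value `1`: an
eigenvector is excluded by the energy identity. -/
lemma isUnit_ellip (hσ : Supercritical d σ) {F : CoeffSpace d}
    (hF : ∀ x, (ev hσ x F).im = 0) : IsUnit (ellip hσ F) := by
  have hcomp : IsCompactOperator ⇑(resolv d * (1 - expS hσ F) : CoeffSpace d →L[ℂ] CoeffSpace d) :=
    (isCompactOperator_resolv hσ).comp_clm (1 - expS hσ F)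
  rcases hcomp.hasEigenvalue_or_mem_resolventSet (one_ne_zero (α := ℂ)) with h | h
  · exfalso
    obtain ⟨v, hv⟩ := h.exists_hasEigenvector
    refine hv.2 (eq_zero_of_ellip_eq_zero hσ hF ?_)
    have := hv.apply_eq_smul
    rw [one_smul] at this
    exact this
  · rw [spectrum.mem_resolventSet_iff, map_one] at h
    convert h using 1
    rw [ellip, mul_sub, mul_sub]
    abel

/-- The map `F ↦ (1 - Δ)⁻¹ (-ΔF + e^F)` on `H^σ`. -/
def poissonMap (hσ : Supercritical d σ) (F : CoeffSpace d) : CoeffSpace d :=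
  F + resolv d (expS hσ F (oneS d) - F)

lemma hasStrictFDerivAt_poissonMap (hσ : Supercritical d σ) (F : CoeffSpace d) :
    HasStrictFDerivAt (poissonMap hσ) (ellip hσ F) F := by
  have h1 := (ContinuousLinearMap.apply ℂ (CoeffSpace d) (oneS d)).hasStrictFDerivAt.comp F
    (hasStrictFDerivAt_expS hσ F)
  have h2 := (resolv d).hasStrictFDerivAt.comp F (h1.sub (hasStrictFDerivAt_id F))
  refine ((hasStrictFDerivAt_id F).add h2).congr_fderiv ?_
  refine ContinuousLinearMap.ext fun v => ?_
  -- The function `e^F` is the operator `expS` applied to `1`, so its derivative in direction `v` is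
  -- `e^F v`.
  have h3 : mulS hσ v (oneS d) = v := ev_injective hσ fun x => by rw [ev_mulS, ev_oneS, mul_one]
  have h4 : (expS hσ F * mulS hσ v) (oneS d) = expS hσ F v := by
    rw [mul_apply_eq_comp, h3]
  change v + resolv d ((expS hσ F * mulS hσ v) (oneS d) - v) = v + resolv d (expS hσ F v - v)
  rw [h4]

/-- Continuity keeps `F τ` in the neighbourhood of `F t` where the local inverse of `poissonMap` is
a left inverse. There `F` is that inverse composed with the differentiable curve `R`. -/
lemma hasDerivAt_of_poissonMap (hσ : Supercritical d σ) {F R : ℝ → CoeffSpace d}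
    {R' : CoeffSpace d} {t : ℝ} (hF : ContinuousAt F t) (hreal : ∀ x, (ev hσ x (F t)).im = 0)
    (hR : HasDerivAt R R' t) (h : ∀ᶠ τ in nhds t, poissonMap hσ (F τ) = R τ) :
    HasDerivAt F (Ring.inverse (ellip hσ (F t)) R') t := by
  obtain ⟨U, hU⟩ := isUnit_ellip hσ hreal
  let e : CoeffSpace d ≃L[ℂ] CoeffSpace d := ContinuousLinearEquiv.unitsEquiv ℂ _ U
  have he : (e : CoeffSpace d →L[ℂ] CoeffSpace d) = ellip hσ (F t) := by
    rw [← hU]; rfl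
  have hes : (e.symm : CoeffSpace d →L[ℂ] CoeffSpace d) = Ring.inverse (ellip hσ (F t)) := by
    rw [← hU, Ring.inverse_unit]; rfl
  have hs : HasStrictFDerivAt (poissonMap hσ) (e : CoeffSpace d →L[ℂ] CoeffSpace d) (F t) := by
    rw [he]; exact hasStrictFDerivAt_poissonMap hσ (F t)
  have h1 := hs.to_localInverse.hasFDerivAt
  rw [h.self_of_nhds, hes] at h1
  have h2 := (h1.restrictScalars ℝ).comp_hasDerivAt t hR
  refine h2.congr_of_eventuallyEq ?_
  filter_upwards [h, hF.eventually hs.eventually_left_inverse] with τ h3 h4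
  rw [Function.comp_apply, ← h3, h4]

/-! ### Classical functions on the torus -/

lemma isOpenQuotientMap_torus :
    IsOpenQuotientMap fun (y : Fin d → ℝ) (i : Fin d) => (y i : UnitAddCircle) :=
  IsOpenQuotientMap.piMap fun _ => QuotientAddGroup.isOpenQuotientMap_mk

lemma IsCn.continuous {n : ℕ} {f : UnitAddTorus (Fin d) → ℝ} (hf : IsCn n f) : Continuous f :=
  isOpenQuotientMap_torus.isQuotientMap.continuous_iff.mpr (ContDiff.continuous hf)

lemma IsCn.mono {n : ℕ} {f : UnitAddTorus (Fin d) → ℝ} (hf : IsCn n f) {m : ℕ} (h : m ≤ n) :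
    IsCn m f :=
  ContDiff.of_le hf (by exact_mod_cast h)

lemma IsCn.mul {n : ℕ} {f g : UnitAddTorus (Fin d) → ℝ} (hf : IsCn n f) (hg : IsCn n g) :
    IsCn n fun x => f x * g x :=
  ContDiff.mul hf hg

lemma IsCn.sub {n : ℕ} {f g : UnitAddTorus (Fin d) → ℝ} (hf : IsCn n f) (hg : IsCn n g) :
    IsCn n fun x => f x - g x :=
  ContDiff.sub hf hg

lemma IsCn.exp {n : ℕ} {f : UnitAddTorus (Fin d) → ℝ} (hf : IsCn n f) :
    IsCn n fun x => Real.exp (f x) :=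
  ContDiff.exp hf

lemma coe_add_single (y : Fin d → ℝ) (i : Fin d) (h : ℝ) :
    (fun j => (y j : UnitAddCircle)) + Pi.single i (h : UnitAddCircle)
      = fun j => ((y + h • Pi.single i 1 : Fin d → ℝ) j : UnitAddCircle) := by
  ext j
  by_cases hj : j = i
  · subst hj; simp
  · simp [hj]

lemma IsCn.hasDerivAt_lift {f : UnitAddTorus (Fin d) → ℝ} (hf : IsCn 1 f) (i : Fin d)
    (y : Fin d → ℝ) (h : ℝ) :
    HasDerivAt (fun h : ℝ => f ((fun j => (y j : UnitAddCircle))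
        + Pi.single i (h : UnitAddCircle)))
      (fderiv ℝ (fun y : Fin d → ℝ => f fun j => (y j : UnitAddCircle))
        (y + h • Pi.single i 1) (Pi.single i 1)) h := by
  simp only [coe_add_single]
  have h1 := (ContDiff.differentiable hf (by norm_num) (y + h • Pi.single i 1)).hasFDerivAt
  have h2 : HasDerivAt (fun h : ℝ => y + h • (Pi.single i 1 : Fin d → ℝ)) (Pi.single i 1) h := by
    simpa using ((hasDerivAt_id h).smul_const (Pi.single i 1 : Fin d → ℝ)).const_add y
  exact h1.comp_hasDerivAt h h2

lemma IsCn.pderiv_coe {f : UnitAddTorus (Fin d) → ℝ} (hf : IsCn 1 f) (i : Fin d)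
    (y : Fin d → ℝ) :
    pderiv i f (fun j => (y j : UnitAddCircle))
      = fderiv ℝ (fun y : Fin d → ℝ => f fun j => (y j : UnitAddCircle)) y (Pi.single i 1) := by
  rw [pderiv, (hf.hasDerivAt_lift i y 0).deriv, zero_smul, add_zero]

lemma IsCn.hasDerivAt {f : UnitAddTorus (Fin d) → ℝ} (hf : IsCn 1 f) (i : Fin d)
    (x : UnitAddTorus (Fin d)) (h : ℝ) :
    HasDerivAt (fun h : ℝ => f (x + Pi.single i (h : UnitAddCircle)))
      (pderiv i f (x + Pi.single i (h : UnitAddCircle))) h := by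
  obtain ⟨y, rfl⟩ := isOpenQuotientMap_torus.surjective x
  rw [coe_add_single, hf.pderiv_coe]
  exact hf.hasDerivAt_lift i y h

lemma IsCn.hasDerivAt_zero {f : UnitAddTorus (Fin d) → ℝ} (hf : IsCn 1 f) (i : Fin d)
    (x : UnitAddTorus (Fin d)) :
    HasDerivAt (fun h : ℝ => f (x + Pi.single i (h : UnitAddCircle))) (pderiv i f x) 0 := by
  simpa using hf.hasDerivAt i x 0

lemma IsCn.continuous_pderiv {f : UnitAddTorus (Fin d) → ℝ} (hf : IsCn 1 f) (i : Fin d) :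
    Continuous (pderiv i f) := by
  refine isOpenQuotientMap_torus.isQuotientMap.continuous_iff.mpr ?_
  have h1 := (ContDiff.continuous_fderiv hf (by norm_num)).clm_apply
    (continuous_const (y := (Pi.single i 1 : Fin d → ℝ)))
  exact h1.congr fun y => (hf.pderiv_coe i y).symm

lemma pderiv_sub {f g : UnitAddTorus (Fin d) → ℝ} (hf : IsCn 1 f) (hg : IsCn 1 g) (i : Fin d)
    (x : UnitAddTorus (Fin d)) :
    pderiv i (fun y => f y - g y) x = pderiv i f x - pderiv i g x :=
  ((hf.hasDerivAt_zero i x).sub (hg.hasDerivAt_zero i x)).deriv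

lemma pderiv_mul {f g : UnitAddTorus (Fin d) → ℝ} (hf : IsCn 1 f) (hg : IsCn 1 g) (i : Fin d)
    (x : UnitAddTorus (Fin d)) :
    pderiv i (fun y => f y * g y) x = pderiv i f x * g x + f x * pderiv i g x := by
  refine ((hf.hasDerivAt_zero i x).mul (hg.hasDerivAt_zero i x)).deriv.trans ?_
  simp

lemma integrable_of_continuous {f : UnitAddTorus (Fin d) → ℝ} (hf : Continuous f) :
    Integrable f (torusMeasure d) :=
  hf.integrable_of_hasCompactSupport (HasCompactSupport.of_compactSpace _)

/-- By translation invariance the integral of `f (x + h e_i)` is constant in `h`; differentiate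
under the integral at `h = 0`. -/
lemma integral_pderiv {f : UnitAddTorus (Fin d) → ℝ} (hf : IsCn 1 f) (i : Fin d) :
    ∫ x, pderiv i f x ∂torusMeasure d = 0 := by
  have hc := hf.continuous
  have hc' := hf.continuous_pderiv i
  obtain ⟨C, hC⟩ := isCompact_univ.exists_bound_of_continuousOn hc'.continuousOn
  have hm (h : ℝ) : Continuous fun x : UnitAddTorus (Fin d) =>
      x + Pi.single i (h : UnitAddCircle) := continuous_add_const _
  have hF (h : ℝ) : Continuous fun x : UnitAddTorus (Fin d) =>
      f (x + Pi.single i (h : UnitAddCircle)) :=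
    (hc.comp (hm h) :)
  have hF' (h : ℝ) : Continuous fun x : UnitAddTorus (Fin d) =>
      pderiv i f (x + Pi.single i (h : UnitAddCircle)) :=
    (hc'.comp (hm h) :)
  have h1 : HasDerivAt
      (fun h : ℝ => ∫ x, f (x + Pi.single i (h : UnitAddCircle)) ∂torusMeasure d)
      (∫ x, pderiv i f (x + Pi.single i ((0 : ℝ) : UnitAddCircle)) ∂torusMeasure d) 0 :=
    (hasDerivAt_integral_of_dominated_loc_of_deriv_le (bound := fun _ => C) Filter.univ_mem
      (.of_forall fun h => (hF h).aestronglyMeasurable) (integrable_of_continuous (hF 0))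
      (hF' 0).aestronglyMeasurable (.of_forall fun x h _ => hC _ (mem_univ _))
      (integrable_const C) (.of_forall fun x h _ => hf.hasDerivAt i x h)).2
  have h2 : (fun h : ℝ => ∫ x, f (x + Pi.single i (h : UnitAddCircle)) ∂torusMeasure d)
      = fun _ => ∫ x, f x ∂torusMeasure d :=
    funext fun h => integral_add_right_eq_self f _
  rw [h2] at h1
  simpa using h1.unique (hasDerivAt_const 0 _)

/-- A divergence-free `C^1` gradient field on the torus vanishes. -/
lemma eq_zero_of_divergence_eq_zero {v : UnitAddTorus (Fin d) → Fin d → ℝ}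
    (hv : ∀ i, IsCn 1 fun x => v x i) (hdiv : ∀ x, divergence v x = 0)
    {χ : UnitAddTorus (Fin d) → ℝ} (hχ : IsCn 1 χ) (hgrad : ∀ x i, v x i = pderiv i χ x)
    (x : UnitAddTorus (Fin d)) : v x = 0 := by
  have hcv : ∀ i, Continuous fun x => v x i := fun i => (hv i).continuous
  -- With `v = ∇χ` and `∇·v = 0` one has `|v|² = ∇·(χ v)`, whose integral is zero.
  have hpt : ∀ x, ∑ i, v x i ^ 2 = ∑ i, pderiv i (fun y => χ y * v y i) x := by
    intro x
    have h : ∑ i, pderiv i (fun y => χ y * v y i) x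
        = ∑ i, v x i ^ 2 + χ x * divergence v x := by
      rw [divergence, Finset.mul_sum, ← Finset.sum_add_distrib]
      refine Finset.sum_congr rfl fun i _ => ?_
      rw [pderiv_mul hχ (hv i), ← hgrad]
      ring
    rw [h, hdiv, mul_zero, add_zero]
  have hcont : Continuous fun x => ∑ i, v x i ^ 2 := by fun_prop
  have hzero : ∫ x, ∑ i, v x i ^ 2 ∂torusMeasure d = 0 := by
    simp only [hpt]
    rw [integral_finsetSum _ fun i _ =>
      integrable_of_continuous ((hχ.mul (hv i)).continuous_pderiv i)]
    exact Finset.sum_eq_zero fun i _ => integral_pderiv (hχ.mul (hv i)) i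
  have hnn : ∀ x, 0 ≤ ∑ i, v x i ^ 2 := fun x => Finset.sum_nonneg fun i _ => sq_nonneg _
  have hae := (integral_eq_zero_iff_of_nonneg hnn (integrable_of_continuous hcont)).mp hzero
  have heq := congrFun ((hcont.ae_eq_iff_eq (torusMeasure d) continuous_zero).mp hae) x
  ext i
  have := (Finset.sum_eq_zero_iff_of_nonneg fun i _ => sq_nonneg (v x i)).mp heq i
    (Finset.mem_univ i)
  simpa using this

/-! ### Sobolev functions and their coordinates -/

lemma continuous_isSobolevWith {f : UnitAddTorus (Fin d) → ℝ} {F : CoeffSpace d}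
    (hσ : Supercritical d σ) (hf : ∀ x, (f x : ℂ) = ev hσ x F) : IsSobolevWith σ f F := by
  have hc : Continuous f := by
    have : f = fun x => (ev hσ x F).re := by ext x; rw [← hf, Complex.ofReal_re]
    rw [this]
    exact Complex.continuous_re.comp (continuous_ev hσ F)
  refine ⟨hc.memLp_of_hasCompactSupport (HasCompactSupport.of_compactSpace _), fun k => ?_⟩
  have : (fun x => (f x : ℂ)) = wser (wco σ F) := by ext x; rw [hf, ev_apply]
  rw [this, mFourierCoeff_wser (summable_mul_wco hσ F), wco_mul_weight]

lemma IsSobolevWith.ae_eq {f : UnitAddTorus (Fin d) → ℝ} {F : CoeffSpace d}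
    (hσ : Supercritical d σ) (hf : IsSobolevWith σ f F) :
    (fun x => (f x : ℂ)) =ᵐ[torusMeasure d] fun x => ev hσ x F := by
  have hev : MemLp (fun x => ev hσ x F) 2 (torusMeasure d) :=
    (continuous_ev hσ F).memLp_of_hasCompactSupport (HasCompactSupport.of_compactSpace _)
  have hfC : MemLp (fun x => (f x : ℂ)) 2 (torusMeasure d) := hf.1.ofReal
  have := ae_eq_zero_of_mFourierCoeff_eq_zero (hfC.sub hev) fun k => ?_
  · filter_upwards [this] with x hx
    simpa [sub_eq_zero] using hx
  · have h1 : mFourierCoeff (fun x => (f x : ℂ)) k = wco σ F k := by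
      have : (sobolevWeight σ k : ℂ) ≠ 0 := by exact_mod_cast (sobolevWeight_pos σ k).ne'
      rw [wco, hf.2 k]; field_simp
    have h2 : mFourierCoeff (fun x => ev hσ x F) k = wco σ F k := by
      simp only [ev_apply]
      exact mFourierCoeff_wser (summable_mul_wco hσ F) k
    rw [mFourierCoeff_def] at h1 h2 ⊢
    have hint : ∀ g : UnitAddTorus (Fin d) → ℂ, MemLp g 2 (torusMeasure d) →
        Integrable (fun x => mFourier (-k) x * g x) (torusMeasure d) := by
      intro g hg
      refine (hg.integrable one_le_two).bdd_mul (c := 1)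
        (mFourier (-k)).continuous.aestronglyMeasurable (.of_forall fun x => ?_)
      rw [norm_mFourier_apply]
    simp only [Pi.sub_apply, mul_sub]
    rw [integral_sub (hint _ hfC) (hint _ hev), h1, h2, sub_self]

lemma IsSobolevWith.eq {f : UnitAddTorus (Fin d) → ℝ} {F : CoeffSpace d}
    (hσ : Supercritical d σ) (hf : IsSobolevWith σ f F) (hc : Continuous f)
    (x : UnitAddTorus (Fin d)) : (f x : ℂ) = ev hσ x F :=
  congrFun (((Complex.continuous_ofReal.comp hc).ae_eq_iff_eq (torusMeasure d)
    (continuous_ev hσ F)).mp (hf.ae_eq hσ)) x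

/-- Almost everywhere equality with a real function suffices, as evaluation is continuous.
Continuity of `f` is not needed, so this also applies at the end times `0` and `T`. -/
lemma IsSobolevWith.im_eq_zero {f : UnitAddTorus (Fin d) → ℝ} {F : CoeffSpace d}
    (hσ : Supercritical d σ) (hf : IsSobolevWith σ f F) (x : UnitAddTorus (Fin d)) :
    (ev hσ x F).im = 0 := by
  have h : (fun x => (ev hσ x F).im) =ᵐ[torusMeasure d] fun _ => (0 : ℝ) := by
    filter_upwards [hf.ae_eq hσ] with x hx
    rw [← hx, Complex.ofReal_im]
  exact congrFun (((Complex.continuous_im.comp (continuous_ev hσ F)).ae_eq_iff_eq (torusMeasure d)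
    continuous_const).mp h) x

/-! ### Derivatives in coordinates -/

/-- The derivative `∂_i : H^{σ+1} → H^σ`, in coordinates. -/
def derivS (i : Fin d) : CoeffSpace d →L[ℂ] CoeffSpace d :=
  diag (fun k => dsym i k / sobolevWeight 1 k) (C := 2 * Real.pi) fun k => by
    have h := sobolevWeight_pos 1 k
    rw [norm_div, norm_dsym, Complex.norm_real, Real.norm_of_nonneg h.le, div_le_iff₀ h]
    exact mul_le_mul_of_nonneg_left (abs_le_sobolevWeight_one k i) (by positivity)

lemma wco_derivS (σ : ℝ) (i : Fin d) (F : CoeffSpace d) (k : Fin d → ℤ) :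
    wco σ (derivS i F) k = dsym i k * wco (σ + 1) F k := by
  rw [wco, wco, derivS, diag_apply, sobolevWeight_add]
  push_cast
  ring

/-- The inclusion `H^{σ+1} → H^σ`, in coordinates. -/
def inclS (d : ℕ) : CoeffSpace d →L[ℂ] CoeffSpace d :=
  diag (fun k => ((sobolevWeight 1 k)⁻¹ : ℂ)) (C := 1) fun k => by
    rw [norm_inv, Complex.norm_real, Real.norm_of_nonneg (sobolevWeight_pos 1 k).le]
    refine inv_le_one_of_one_le₀ ?_
    simpa [sobolevWeight] using sobolevWeight_mono (zero_le_one (α := ℝ)) k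

lemma wco_inclS (σ : ℝ) (F : CoeffSpace d) (k : Fin d → ℤ) :
    wco σ (inclS d F) k = wco (σ + 1) F k := by
  rw [wco, wco, inclS, diag_apply, sobolevWeight_add]
  push_cast
  ring

/-- The resolvent `(1 - Δ)⁻¹ : H^σ → H^{σ+2}`, in coordinates. -/
def liftS (d : ℕ) : CoeffSpace d →L[ℂ] CoeffSpace d :=
  diag (fun k => (bracketSq k : ℂ) * (1 + lapSym k : ℂ)⁻¹) (C := 1) fun k => by
    rw [norm_mul, norm_inv, norm_one_add_lapSym, Complex.norm_real,
      Real.norm_of_nonneg (bracketSq_pos k).le, ← div_eq_mul_inv,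
      div_le_one (by linarith [lapSym_nonneg k])]
    exact bracketSq_le_one_add_lapSym k

lemma wco_liftS (σ : ℝ) (F : CoeffSpace d) (k : Fin d → ℤ) :
    wco (σ + 1 + 1) (liftS d F) k = (1 + lapSym k : ℂ)⁻¹ * wco σ F k := by
  have h : sobolevWeight (σ + 1 + 1) k = sobolevWeight σ k * bracketSq k := by
    rw [add_assoc, one_add_one_eq_two, sobolevWeight_add, sobolevWeight_two]
  have h1 : (sobolevWeight σ k : ℂ) ≠ 0 := by exact_mod_cast (sobolevWeight_pos σ k).ne'
  have h2 : (bracketSq k : ℂ) ≠ 0 := by exact_mod_cast (bracketSq_pos k).ne'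
  have h3 := one_add_lapSym_ne_zero k
  rw [wco, wco, liftS, diag_apply, h]
  push_cast
  field_simp

/-- The operator `∂_i (-Δ)⁻¹` on mean-free functions, in coordinates. -/
def fluxS (i : Fin d) : CoeffSpace d →L[ℂ] CoeffSpace d :=
  diag (fun k => dsym i k * (lapSym k : ℂ)⁻¹) (C := 2 * Real.pi) fun k => by
    rw [norm_mul, norm_dsym, norm_inv, Complex.norm_real, Real.norm_of_nonneg (lapSym_nonneg k)]
    rcases eq_or_ne k 0 with rfl | hk
    -- At `k = 0` the inverse of `lapSym 0 = 0` is `0` by convention, so the multiplier discards the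
    -- mean.
    · simp [Real.pi_pos.le]
    · have h1 := bracketSq_le_lapSym hk
      have h2 := (bracketSq_pos k).trans_le h1
      have h3 : |(k i : ℝ)| ≤ lapSym k := by
        refine ((abs_le_sobolevWeight_one k i).trans (sobolevWeight_mono one_le_two k)).trans ?_
        rwa [sobolevWeight_two]
      rw [← div_eq_mul_inv, div_le_iff₀ h2]
      exact mul_le_mul_of_nonneg_left h3 (by positivity)

lemma wco_fluxS (σ : ℝ) (i : Fin d) (F : CoeffSpace d) (k : Fin d → ℤ) :
    wco σ (fluxS i F) k = dsym i k * ((lapSym k : ℂ)⁻¹ * wco σ F k) := by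
  rw [wco, wco, fluxS, diag_apply]
  ring

lemma summable_dsym_wco (hσ : Supercritical d σ) (i : Fin d) (F : CoeffSpace d) :
    Summable fun k => ‖dsym i k * wco (σ + 1) F k‖ := by
  simp only [← wco_derivS]
  exact summable_mul_wco hσ _

lemma Supercritical.succ (hσ : Supercritical d σ) : Supercritical d (σ + 1) :=
  hσ.mono (by linarith)

lemma ofReal_pderiv_eq_ev (hσ : Supercritical d σ) {f : UnitAddTorus (Fin d) → ℝ}
    {F : CoeffSpace d} (hf : ∀ x, (f x : ℂ) = ev hσ.succ x F) (i : Fin d)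
    (x : UnitAddTorus (Fin d)) : (pderiv i f x : ℂ) = ev hσ x (derivS i F) := by
  simp only [ev_apply] at hf ⊢
  rw [ofReal_pderiv (summable_mul_wco hσ.succ F) (summable_dsym_wco hσ i F) hf]
  congr 1
  ext k
  rw [wco_derivS]

lemma ofReal_divergence_eq_ev (hσ : Supercritical d σ) {v : UnitAddTorus (Fin d) → Fin d → ℝ}
    {F : Fin d → CoeffSpace d} (hv : ∀ x i, (v x i : ℂ) = ev hσ.succ x (F i))
    (x : UnitAddTorus (Fin d)) :
    (divergence v x : ℂ) = ev hσ x (∑ i, derivS i (F i)) := by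
  rw [divergence, map_sum, Complex.ofReal_sum]
  exact Finset.sum_congr rfl fun i _ => ofReal_pderiv_eq_ev hσ (fun x => hv x i) i x

lemma isCn_one_of_ev (hσ : Supercritical d σ) {f : UnitAddTorus (Fin d) → ℝ}
    {F : CoeffSpace d} (hf : ∀ x, (f x : ℂ) = ev hσ.succ x F) : IsCn 1 f := by
  refine isCn_one_of_wser (summable_mul_wco hσ.succ F) (fun i => summable_dsym_wco hσ i F)
    fun x => ?_
  rw [← ev_apply hσ.succ, ← hf, Complex.ofReal_re]

lemma ofReal_laplacian_eq_ev (hσ : Supercritical d σ) {f : UnitAddTorus (Fin d) → ℝ}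
    {F : CoeffSpace d} (hf : ∀ x, (f x : ℂ) = ev hσ.succ.succ x F) (x : UnitAddTorus (Fin d)) :
    (laplacian f x : ℂ) = ev hσ x (∑ i, derivS i (derivS i F)) :=
  ofReal_divergence_eq_ev (v := fun x i => pderiv i f x) hσ
    (fun x i => ofReal_pderiv_eq_ev hσ.succ hf i x) x

lemma wco_add (F G : CoeffSpace d) (k : Fin d → ℤ) : wco σ (F + G) k = wco σ F k + wco σ G k :=
  add_div _ _ _

lemma wco_sub (F G : CoeffSpace d) (k : Fin d → ℤ) : wco σ (F - G) k = wco σ F k - wco σ G k :=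
  sub_div _ _ _

lemma wco_neg (F : CoeffSpace d) (k : Fin d → ℤ) : wco σ (-F) k = -wco σ F k :=
  neg_div _ _

lemma wco_sum {ι : Type*} (s : Finset ι) (F : ι → CoeffSpace d) (k : Fin d → ℤ) :
    wco σ (∑ i ∈ s, F i) k = ∑ i ∈ s, wco σ (F i) k := by
  simp only [wco, lp.coeFn_sum, Finset.sum_apply, Finset.sum_div]

lemma wco_resolv (F : CoeffSpace d) (k : Fin d → ℤ) :
    wco σ (resolv d F) k = (1 + lapSym k : ℂ)⁻¹ * wco σ F k := by
  rw [wco, wco, resolv_apply, mul_div_assoc]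

lemma ev_inclS (hσ : Supercritical d σ) (F : CoeffSpace d) (x : UnitAddTorus (Fin d)) :
    ev hσ x (inclS d F) = ev hσ.succ x F := by
  rw [ev_apply, ev_apply]
  congr 1
  ext k
  rw [wco_inclS]

lemma sum_derivS_derivS (F : CoeffSpace d) (k : Fin d → ℤ) :
    wco σ (∑ i, derivS i (derivS i F)) k = -(lapSym k : ℂ) * wco (σ + 1 + 1) F k := by
  rw [wco_sum, ← sum_dsym_mul_self, Finset.sum_mul]
  refine Finset.sum_congr rfl fun i _ => ?_
  rw [wco_derivS, wco_derivS, mul_assoc]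

/-- The Poisson equation, in coordinates. -/
lemma poissonMap_eq (hσ : Supercritical d σ) {ρ Φ : UnitAddTorus (Fin d) → ℝ}
    {R F : CoeffSpace d} (hρ : ∀ x, (ρ x : ℂ) = ev hσ.succ x R)
    (hΦ : ∀ x, (Φ x : ℂ) = ev hσ.succ.succ x F)
    (hP : ∀ x, -laplacian Φ x = ρ x - Real.exp (Φ x)) :
    poissonMap hσ.succ.succ F = liftS d (inclS d R) := by
  have h : -∑ i, derivS i (derivS i F)
      = inclS d R - inclS d (inclS d (expS hσ.succ.succ F (oneS d))) := by
    refine ev_injective hσ fun x => ?_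
    rw [map_neg, ← ofReal_laplacian_eq_ev hσ hΦ, map_sub, ev_inclS, ev_inclS, ev_inclS, ev_expS,
      ev_oneS, mul_one, ← hΦ, ← hρ]
    exact_mod_cast hP x
  -- The Poisson equation was read off pointwise in `H^σ`; coefficientwise, division by `1 + lapSym
  -- k` moves it to `H^{σ+2}`.
  refine wco_injective (σ := σ + 1 + 1) (funext fun k => ?_)
  have hk := congrArg (fun G => wco σ G k) h
  simp only [wco_neg, sum_derivS_derivS, wco_sub, wco_inclS] at hk
  have h1 := one_add_lapSym_ne_zero k
  rw [poissonMap, wco_add, wco_resolv, wco_sub, wco_liftS, wco_inclS]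
  field_simp
  linear_combination hk

/-! ### Real symbols -/

lemma dsym_neg (i : Fin d) (k : Fin d → ℤ) : dsym i (-k) = conj (dsym i k) := by
  have h2 : conj (2 : ℂ) = 2 := Complex.conj_ofNat 2
  simp [dsym, Complex.conj_ofReal, h2]

lemma lapSym_neg (k : Fin d → ℤ) : lapSym (-k) = lapSym k := by
  simp [lapSym]

/-- Real functions are those with Hermitian Fourier coefficients, a symmetry preserved by Hermitian
symbols. -/
lemma im_ev_diag_eq_zero (hσ : Supercritical d σ) {m : (Fin d → ℤ) → ℂ} {C : ℝ}
    (hm : ∀ k, ‖m k‖ ≤ C) (hreal : ∀ k, m (-k) = conj (m k)) {F : CoeffSpace d}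
    (hF : ∀ x, (ev hσ x F).im = 0) (x : UnitAddTorus (Fin d)) :
    (ev hσ x (diag m hm F)).im = 0 := by
  simp only [ev_apply] at hF ⊢
  rw [wser_im_eq_zero_iff (summable_mul_wco hσ F)] at hF
  refine (wser_im_eq_zero_iff (summable_mul_wco hσ _)).mpr (fun k => ?_) x
  have h : ∀ k, wco σ (diag m hm F) k = m k * wco σ F k := fun k => by
    rw [wco, wco, diag_apply, mul_div_assoc]
  rw [h, h, hF, hreal, map_mul]

lemma im_ev_fluxS_eq_zero (hσ : Supercritical d σ) {F : CoeffSpace d}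
    (hF : ∀ x, (ev hσ x F).im = 0) (i : Fin d) (x : UnitAddTorus (Fin d)) :
    (ev hσ x (fluxS i F)).im = 0 :=
  im_ev_diag_eq_zero hσ _ (fun k => by
    rw [dsym_neg, lapSym_neg, map_mul, map_inv₀, Complex.conj_ofReal]) hF x

/-- The operator `(-Δ)⁻¹` on mean-free functions, in coordinates. -/
def invLapS (d : ℕ) : CoeffSpace d →L[ℂ] CoeffSpace d :=
  diag (fun k => (lapSym k : ℂ)⁻¹) (C := 1) fun k => by
    rw [norm_inv, Complex.norm_real, Real.norm_of_nonneg (lapSym_nonneg k)]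
    rcases eq_or_ne k 0 with rfl | hk
    · simp [lapSym]
    · exact inv_le_one_of_one_le₀ ((one_le_bracketSq k).trans (bracketSq_le_lapSym hk))

lemma im_ev_invLapS_eq_zero (hσ : Supercritical d σ) {F : CoeffSpace d}
    (hF : ∀ x, (ev hσ x F).im = 0) (x : UnitAddTorus (Fin d)) :
    (ev hσ x (invLapS d F)).im = 0 :=
  im_ev_diag_eq_zero hσ _ (fun k => by rw [lapSym_neg, map_inv₀, Complex.conj_ofReal]) hF x

lemma ofReal_re_of_im_eq_zero {z : ℂ} (hz : z.im = 0) : (z.re : ℂ) = z :=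
  Complex.ext (by simp) (by simp [hz])

lemma derivS_invLapS (i : Fin d) (F : CoeffSpace d) :
    derivS i (invLapS d F) = inclS d (fluxS i F) := by
  -- The exponent is immaterial, since `wco` is injective for every `σ`.
  refine wco_injective (σ := 0) (funext fun k => ?_)
  rw [wco_derivS, wco_inclS, wco_fluxS, wco, wco, invLapS, diag_apply, mul_div_assoc]

/-- The symbol of the left side is `-1` away from `k = 0` and `0` there, hence the mean-zero
condition. -/
lemma sum_derivS_fluxS {F : CoeffSpace d} (hF : F 0 = 0) :
    ∑ i, derivS i (fluxS i F) = -inclS d F := by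
  refine wco_injective (σ := 0) (funext fun k => ?_)
  simp only [wco_sum, wco_neg, wco_derivS, wco_fluxS, wco_inclS, ← mul_assoc, ← Finset.sum_mul,
    sum_dsym_mul_self]
  rcases eq_or_ne k 0 with rfl | hk
  · simp [wco, hF]
  · have h : (lapSym k : ℂ) ≠ 0 := by
      exact_mod_cast ((bracketSq_pos k).trans_le (bracketSq_le_lapSym hk)).ne'
    field_simp

/-! ### The electron velocity field -/

/-- `-∇·(ρ u) ∈ H^σ`, in coordinates, for `ρ, u ∈ H^{σ+1}`. -/
def densityRate (hσ : Supercritical d σ) (R : CoeffSpace d) (U : Fin d → CoeffSpace d) :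
    CoeffSpace d :=
  -∑ i, derivS i (mulS hσ.succ R (U i))

/-- `∂_t Φ ∈ H^{σ+2}`, in coordinates. -/
def potentialRate (hσ : Supercritical d σ) (R : CoeffSpace d) (U : Fin d → CoeffSpace d)
    (F : CoeffSpace d) : CoeffSpace d :=
  Ring.inverse (ellip hσ.succ.succ F) (liftS d (densityRate hσ R U))

/-- `∂_t e^Φ ∈ H^{σ+2}`, in coordinates. -/
def electronRate (hσ : Supercritical d σ) (R : CoeffSpace d) (U : Fin d → CoeffSpace d)
    (F : CoeffSpace d) : CoeffSpace d :=
  expS hσ.succ.succ F (potentialRate hσ R U F)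

/-- The electron velocity `e^{-Φ} ∇ (-Δ)⁻¹ ∂_t e^Φ ∈ H^{σ+2}`, in coordinates. -/
def electronVelocity (hσ : Supercritical d σ) (R : CoeffSpace d) (U : Fin d → CoeffSpace d)
    (F : CoeffSpace d) (i : Fin d) : CoeffSpace d :=
  expS hσ.succ.succ (-F) (fluxS i (electronRate hσ R U F))

section

variable (hσ : Supercritical d σ) {R F : ℝ → CoeffSpace d} {U : Fin d → ℝ → CoeffSpace d}
  {s : Set ℝ}

lemma continuousOn_densityRate (hR : ContinuousOn R s) (hU : ∀ i, ContinuousOn (U i) s) :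
    ContinuousOn (fun t => densityRate hσ (R t) fun i => U i t) s := by
  unfold densityRate
  refine ContinuousOn.neg (continuousOn_finsetSum _ fun i _ => ?_)
  exact (derivS i).continuous.comp_continuousOn
    (((mulS hσ.succ).continuous.comp_continuousOn hR).clm_apply (hU i))

lemma continuousOn_electronVelocity (hR : ContinuousOn R s) (hU : ∀ i, ContinuousOn (U i) s)
    (hF : ContinuousOn F s) (hreal : ∀ t ∈ s, ∀ x, (ev hσ.succ.succ x (F t)).im = 0) (i : Fin d) :
    ContinuousOn (fun t => electronVelocity hσ (R t) (fun i => U i t) (F t) i) s := by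
  have hinv : ContinuousOn (fun t => Ring.inverse (ellip hσ.succ.succ (F t))) s := by
    intro t ht
    obtain ⟨w, hw⟩ := isUnit_ellip hσ.succ.succ (hreal t ht)
    -- Inversion in a Banach algebra is continuous at units, so invertibility at every time of `s`
    -- is what matters.
    have h1 := NormedRing.inverse_continuousAt w
    rw [hw] at h1
    have h2 : ContinuousWithinAt (fun t => ellip hσ.succ.succ (F t)) s t :=
      (continuous_ellip hσ.succ.succ).comp_continuousOn hF t ht
    exact h1.tendsto.comp h2
  have hV := hinv.clm_apply ((liftS d).continuous.comp_continuousOn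
    (continuousOn_densityRate hσ hR hU))
  have hE := ((continuous_expS hσ.succ.succ).comp_continuousOn hF).clm_apply hV
  exact ((continuous_expS hσ.succ.succ).comp_continuousOn hF.neg).clm_apply
    ((fluxS i).continuous.comp_continuousOn hE)

end

/-- Conservation of total electron charge. In the linearized equation `V + (1-Δ)⁻¹(e^F V - V) =
-(1-Δ)⁻¹∇·(ρu)` the resolvent symbol at `k = 0` is `1` and the divergence has no zero mode, so only
the mean of `e^F V` remains. -/
lemma electronRate_apply_zero (hσ : Supercritical d σ) (R : CoeffSpace d)
    (U : Fin d → CoeffSpace d) {F : CoeffSpace d}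
    (hF : ∀ x, (ev hσ.succ.succ x F).im = 0) : electronRate hσ R U F 0 = 0 := by
  set V := potentialRate hσ R U F with hV
  have h1 : ellip hσ.succ.succ F V = liftS d (densityRate hσ R U) := by
    rw [hV, potentialRate, ← mul_apply_eq_comp, Ring.mul_inverse_cancel _ (isUnit_ellip _ hF)]
    rfl
  have h2 : V + resolv d (electronRate hσ R U F - V) = liftS d (densityRate hσ R U) := h1
  have h3 := congrArg (fun G => wco (σ + 1 + 1) G 0) h2
  simp only [wco_add, wco_resolv, wco_sub, wco_liftS, densityRate, wco_neg, wco_sum,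
    wco_derivS] at h3
  have h4 : wco (σ + 1 + 1) (electronRate hσ R U F) 0 = 0 := by
    simpa [lapSym, dsym] using h3
  simpa [wco, sobolevWeight_zero_right] using h4

/-- Time derivative of the density in `H^σ`. -/
lemma hasDerivAt_density (hσ : Supercritical d σ) {T : ℝ}
    {ρ : ℝ → UnitAddTorus (Fin d) → ℝ} {u : ℝ → UnitAddTorus (Fin d) → Fin d → ℝ}
    {R : ℝ → CoeffSpace d} {U : Fin d → ℝ → CoeffSpace d}
    (hR : ContinuousOn R (Ioo 0 T)) (hU : ∀ i, ContinuousOn (U i) (Ioo 0 T))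
    (hρ : ∀ t ∈ Ioo 0 T, ∀ x, (ρ t x : ℂ) = ev hσ.succ x (R t))
    (hu : ∀ t ∈ Ioo 0 T, ∀ i x, (u t x i : ℂ) = ev hσ.succ x (U i t))
    (hmass : ∀ t ∈ Ioo (0 : ℝ) T, ∀ x,
      HasDerivAt (fun τ => ρ τ x) (-divergence (fun y i => ρ t y * u t y i) x) t)
    {t : ℝ} (ht : t ∈ Ioo 0 T) :
    HasDerivAt (fun τ => inclS d (R τ)) (densityRate hσ (R t) fun i => U i t) t := by
  -- The mass equation is known only pointwise in `x`; since its right side is a continuous curve in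
  -- `H^σ`, it upgrades to a derivative in norm.
  refine hasDerivAt_of_separating (fun x => (ev hσ x).restrictScalars ℝ)
    (fun v w h => ev_injective hσ h) (continuousOn_densityRate hσ hR hU) (fun t ht x => ?_) ht
  have h1 : ((-divergence (fun y i => ρ t y * u t y i) x : ℝ) : ℂ)
      = ev hσ x (densityRate hσ (R t) fun i => U i t) := by
    rw [Complex.ofReal_neg, densityRate, map_neg]
    congr 1
    refine ofReal_divergence_eq_ev hσ (fun y i => ?_) x
    rw [ev_mulS, ← hρ t ht, ← hu t ht, Complex.ofReal_mul]
  have h2 := (hmass t ht x).ofReal_comp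
  rw [h1] at h2
  refine h2.congr_of_eventuallyEq ?_
  filter_upwards [isOpen_Ioo.mem_nhds ht] with τ hτ
  exact (ev_inclS hσ (R τ) x).trans (hρ τ hτ x).symm

/-- Two fields with the same continuity equation and gradient fluxes agree. -/
lemma eq_of_continuityEqAt {Φ : ℝ → UnitAddTorus (Fin d) → ℝ}
    {v w : ℝ → UnitAddTorus (Fin d) → Fin d → ℝ} {t : ℝ} (hΦ : IsCn 1 (Φ t))
    (hv : ContinuityEqAt Φ v t) (hw : ContinuityEqAt Φ w t)
    (hgv : GradientFluxAt Φ v t) (hgw : GradientFluxAt Φ w t) : w t = v t := by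
  obtain ⟨ψ, hψ, hψv⟩ := hgv
  obtain ⟨χ, hχ, hχw⟩ := hgw
  have hfv : ∀ i, IsCn 1 fun y => electronDensity Φ t y * v t y i := fun i => hΦ.exp.mul (hv.1 i)
  have hfw : ∀ i, IsCn 1 fun y => electronDensity Φ t y * w t y i := fun i => hΦ.exp.mul (hw.1 i)
  have hz := eq_zero_of_divergence_eq_zero
    (v := fun y i => electronDensity Φ t y * w t y i - electronDensity Φ t y * v t y i)
    (fun i => (hfw i).sub (hfv i)) (fun x => by
      -- Both flux divergences equal minus the one time derivative of `ρ_e`.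
      have h1 := (hv.2 x).unique (hw.2 x)
      have h2 : divergence (fun y i =>
            electronDensity Φ t y * w t y i - electronDensity Φ t y * v t y i) x
          = divergence (fun y i => electronDensity Φ t y * w t y i) x
            - divergence (fun y i => electronDensity Φ t y * v t y i) x := by
        simp only [divergence, ← Finset.sum_sub_distrib]
        exact Finset.sum_congr rfl fun i _ => pderiv_sub (hfw i) (hfv i) i x
      rw [h2]; linarith)
    (hχ.sub hψ) fun x i => by rw [pderiv_sub hχ hψ, hχw, hψv]
  ext x i
  have h := congrFun (hz x) i
  simp only [Pi.zero_apply, ← mul_sub, mul_eq_zero] at h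
  rcases h with h | h
  · exact absurd h (Real.exp_pos _).ne'
  · linarith

end IonicEulerPoisson

end

/-! ### Construction of the electron velocity and conclusion -/

theorem proposition2p1 (d : ℕ) (hd : 1 ≤ d) (s : ℝ) (hs : (d : ℝ) / 2 + 1 < s)
    (κ : ℝ) (hκ : 0 ≤ κ) (T : ℝ) (hT : 0 < T)
    (ρ : ℝ → UnitAddTorus (Fin d) → ℝ) (u : ℝ → UnitAddTorus (Fin d) → Fin d → ℝ)
    (Φ : ℝ → UnitAddTorus (Fin d) → ℝ)
    (hρ : IonicEulerPoisson.ContSobolev T s ρ)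
    (hu : ∀ i, IonicEulerPoisson.ContSobolev T s (fun t x => u t x i))
    (hΦ : IonicEulerPoisson.ContSobolev T (s + 1) Φ)
    (hsol : IonicEulerPoisson.IsClassicalSolution κ T ρ u Φ) :
    ∃ u_e : ℝ → UnitAddTorus (Fin d) → Fin d → ℝ,
      (∀ i, IonicEulerPoisson.LinftySobolev T (s + 1) (fun t x => u_e t x i)) ∧
      (∀ t ∈ Ioo (0 : ℝ) T, IonicEulerPoisson.ContinuityEqAt Φ u_e t) ∧
      (∀ t ∈ Ioo (0 : ℝ) T, IonicEulerPoisson.GradientFluxAt Φ u_e t) ∧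
      ∀ w : ℝ → UnitAddTorus (Fin d) → Fin d → ℝ,
        (∀ i, IonicEulerPoisson.LinftySobolev T (s + 1) (fun t x => w t x i)) →
        (∀ᵐ t ∂(volume.restrict (Ioo 0 T)), IonicEulerPoisson.ContinuityEqAt Φ w t) →
        (∀ᵐ t ∂(volume.restrict (Ioo 0 T)), IonicEulerPoisson.GradientFluxAt Φ w t) →
        ∀ᵐ t ∂(volume.restrict (Ioo 0 T)), w t = u_e t := by
  open IonicEulerPoisson in
  obtain ⟨σ, rfl⟩ : ∃ σ, s = σ + 1 := ⟨s - 1, by ring⟩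
  have hσ : Supercritical d σ := ⟨hd, by linarith⟩
  obtain ⟨R, hRc, hR⟩ := hρ
  choose U hUc hU using hu
  obtain ⟨F, hFc, hF⟩ := hΦ
  have hIoo : Ioo 0 T ⊆ Icc 0 T := Ioo_subset_Icc_self
  have hΦC1 : ∀ t ∈ Ioo 0 T, IsCn 1 (Φ t) := fun t ht =>
    (hsol.potential_C2 t ht).mono one_le_two
  have hρev : ∀ t ∈ Ioo 0 T, ∀ x, (ρ t x : ℂ) = ev hσ.succ x (R t) := fun t ht =>
    (hR t (hIoo ht)).eq hσ.succ (hsol.density_C1 t ht).continuous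
  have huev : ∀ t ∈ Ioo 0 T, ∀ i x, (u t x i : ℂ) = ev hσ.succ x (U i t) := fun t ht i =>
    (hU i t (hIoo ht)).eq hσ.succ (hsol.velocity_C1 t ht i).continuous
  have hΦev : ∀ t ∈ Ioo 0 T, ∀ x, (Φ t x : ℂ) = ev hσ.succ.succ x (F t) := fun t ht =>
    (hF t (hIoo ht)).eq hσ.succ.succ (hΦC1 t ht).continuous
  -- The closed interval is needed: the velocity coordinates must be continuous up to the end times
  -- to be bounded, although the equations hold only inside.
  have hreal : ∀ t ∈ Icc 0 T, ∀ x, (ev hσ.succ.succ x (F t)).im = 0 := fun t ht =>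
    (hF t ht).im_eq_zero hσ.succ.succ
  let V : ℝ → CoeffSpace d := fun t => potentialRate hσ (R t) (fun i => U i t) (F t)
  let E : ℝ → CoeffSpace d := fun t => electronRate hσ (R t) (fun i => U i t) (F t)
  let W : Fin d → ℝ → CoeffSpace d := fun i t =>
    electronVelocity hσ (R t) (fun i => U i t) (F t) i
  have hWc : ∀ i, ContinuousOn (W i) (Icc 0 T) :=
    continuousOn_electronVelocity hσ hRc hUc hFc hreal
  have hFder : ∀ t ∈ Ioo 0 T, HasDerivAt F (V t) t := by
    intro t ht
    have h1 := hasDerivAt_density hσ (hRc.mono hIoo) (fun i => (hUc i).mono hIoo) hρev huev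
      hsol.mass ht
    -- The density is differentiable only in `H^σ`; `liftS` regains two derivatives and places the
    -- source in `H^{σ+2}`.
    refine hasDerivAt_of_poissonMap hσ.succ.succ (hFc.continuousAt (Icc_mem_nhds ht.1 ht.2))
      (hreal t (hIoo ht)) (((liftS d).restrictScalars ℝ).hasFDerivAt.comp_hasDerivAt t h1) ?_
    filter_upwards [isOpen_Ioo.mem_nhds ht] with τ hτ
    exact poissonMap_eq hσ (hρev τ hτ) (hΦev τ hτ) (hsol.poisson τ hτ)
  have hΦder : ∀ t ∈ Ioo 0 T, ∀ x,
      HasDerivAt (fun τ => Φ τ x) (ev hσ.succ.succ x (V t)).re t ∧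
        (ev hσ.succ.succ x (V t)).im = 0 := by
    intro t ht x
    have h1 : HasDerivAt (fun τ => ((Φ τ x : ℝ) : ℂ)) (ev hσ.succ.succ x (V t)) t := by
      refine (((ev hσ.succ.succ x).restrictScalars ℝ).hasFDerivAt.comp_hasDerivAt t
        (hFder t ht)).congr_of_eventuallyEq ?_
      filter_upwards [isOpen_Ioo.mem_nhds ht] with τ hτ
      exact hΦev τ hτ x
    have h2 : HasDerivAt (fun τ => Φ τ x) (ev hσ.succ.succ x (V t)).re t := by
      simpa [Function.comp_def] using Complex.reCLM.hasFDerivAt.comp_hasDerivAt t h1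
    refine ⟨h2, ?_⟩
    -- The complex derivative of a real curve is real, so `∂_t Φ` needs no separate symmetry
    -- argument for the inverse operator.
    rw [h1.unique h2.ofReal_comp, Complex.ofReal_im]
  have hEev : ∀ t ∈ Ioo 0 T, ∀ x, ev hσ.succ.succ x (E t)
      = ((Real.exp (Φ t x) * (ev hσ.succ.succ x (V t)).re : ℝ) : ℂ) := by
    intro t ht x
    rw [Complex.ofReal_mul, ofReal_re_of_im_eq_zero (hΦder t ht x).2, Complex.ofReal_exp,
      hΦev t ht]
    exact ev_expS ..
  have hflux : ∀ t ∈ Ioo 0 T, ∀ i x, (ev hσ.succ.succ x (fluxS i (E t))).im = 0 :=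
    fun t ht => im_ev_fluxS_eq_zero hσ.succ.succ fun x => by rw [hEev t ht, Complex.ofReal_im]
  have hW : ∀ t ∈ Ioo 0 T, ∀ i x, ev hσ.succ.succ x (W i t)
      = ((Real.exp (-Φ t x) * (ev hσ.succ.succ x (fluxS i (E t))).re : ℝ) : ℂ) := by
    intro t ht i x
    rw [Complex.ofReal_mul, ofReal_re_of_im_eq_zero (hflux t ht i x), Complex.ofReal_exp,
      Complex.ofReal_neg, hΦev t ht, ← map_neg]
    exact ev_expS ..
  let u_e : ℝ → UnitAddTorus (Fin d) → Fin d → ℝ := fun t x i => (ev hσ.succ.succ x (W i t)).re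
  have hue : ∀ t ∈ Ioo 0 T, ∀ i x, (u_e t x i : ℂ) = ev hσ.succ.succ x (W i t) := fun t ht i x =>
    ofReal_re_of_im_eq_zero (by rw [hW t ht, Complex.ofReal_im])
  have hmul : ∀ t ∈ Ioo 0 T, ∀ x i, ((electronDensity Φ t x * u_e t x i : ℝ) : ℂ)
      = ev hσ.succ.succ x (fluxS i (E t)) := by
    intro t ht x i
    rw [Complex.ofReal_mul, hue t ht, hW t ht, ← Complex.ofReal_mul, electronDensity, ← mul_assoc,
      ← Real.exp_add, add_neg_cancel, Real.exp_zero, one_mul,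
      ofReal_re_of_im_eq_zero (hflux t ht i x)]
  have hcont : ∀ t ∈ Ioo 0 T, ContinuityEqAt Φ u_e t := by
    intro t ht
    refine ⟨fun i => isCn_one_of_ev hσ.succ (hue t ht i), fun x => ?_⟩
    refine (hΦder t ht x).1.exp.congr_deriv ?_
    apply Complex.ofReal_injective
    rw [Complex.ofReal_neg, ofReal_divergence_eq_ev hσ.succ (hmul t ht),
      sum_derivS_fluxS (electronRate_apply_zero hσ _ _ (hreal t (hIoo ht))), map_neg, neg_neg,
      ev_inclS]
    exact (hEev t ht x).symm
  have hgrad : ∀ t ∈ Ioo 0 T, GradientFluxAt Φ u_e t := by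
    intro t ht
    have hψ : ∀ x, (((ev hσ.succ.succ x (invLapS d (E t))).re : ℝ) : ℂ)
        = ev hσ.succ.succ x (invLapS d (E t)) := fun x =>
      ofReal_re_of_im_eq_zero (im_ev_invLapS_eq_zero hσ.succ.succ
        (fun x => by rw [hEev t ht, Complex.ofReal_im]) x)
    refine ⟨fun x => (ev hσ.succ.succ x (invLapS d (E t))).re, isCn_one_of_ev hσ.succ hψ,
      fun x i => ?_⟩
    apply Complex.ofReal_injective
    rw [hmul t ht, ofReal_pderiv_eq_ev hσ.succ hψ, derivS_invLapS, ev_inclS]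
  refine ⟨u_e, fun i => ⟨W i, ?_, ?_⟩, hcont, hgrad, fun w _ hw hgw => ?_⟩
  -- Continuity in time on the compact interval gives the essential bound in `H^{s+1}`.
  · obtain ⟨C, hC⟩ := isCompact_Icc.exists_bound_of_continuousOn (hWc i)
    refine memLp_top_of_bound (((hWc i).mono hIoo).aestronglyMeasurable measurableSet_Ioo) C ?_
    filter_upwards [ae_restrict_mem measurableSet_Ioo] with t ht using hC t (hIoo ht)
  · filter_upwards [ae_restrict_mem measurableSet_Ioo] with t ht
    exact continuous_isSobolevWith hσ.succ.succ (hue t ht i)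
  · filter_upwards [ae_restrict_mem measurableSet_Ioo, hw, hgw] with t ht h1 h2
    exact eq_of_continuityEqAt (hΦC1 t ht) (hcont t ht) h1 (hgrad t ht) h2
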